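/- Let $E$ be a measurable space, $\partial\notin E$, and let $(X_t)_{t\ge 0}$ be a (jointly measurable) time-homogeneous Markov process on $E\cup\{\partial\}$, with laws $\mathbb P_x$ and $\mathbb P_\mu=\int_E\mathbb P_x\,\mu(dx)$, which is absorbed in $\partial$ at time $\tau_\partial=\inf\{t\ge 0: X_t=\partial\}$. Assume that, for all $x\in E$, $\tau_\partial<\infty$ $\mathbb P_x$-a.s. and $\mathbb P_x(t<\tau_\partial)>0$ for all $t\ge 0$. Let $\mathcal M_1(E)$ be the set of probability measures on $E$ and $\mathcal B_b(E)$ the set of bounded measurable functions $E\to\mathbb R$ with the sup norm $\|\cdot\|_\infty$, and write $\|\mu_1-\mu_2\|_{TV}=\sup\{|\mu_1(f)-\mu_2(f)|: f\in\mathcal B_b(E),\ \|f\|_\infty\le 1\}$. Assume that there are a probability measure $\nu$ on $E$ and constants $t_0,c_1,c_2>0$ such that $$\text{(A1)}\quad \mathbb P_x(X_{t_0}\in\cdot\mid t_0<\tau_\partial)\ge c_1\nu\quad\forall x\in E,\qquad \text{(A2)}\quad \mathbb P_\nu(t<\tau_\partial)\ge c_2\,\mathbb P_x(t<\tau_\partial)\quad\forall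 t\ge 0,\ x\in E.$$ Put $P_tf(x)=\mathbb E_x[f(X_t)\mathbf 1_{t<\tau_\partial}]$. Then the Green operator $Af(x)=\int_0^\infty P_sf(x)\,ds$ is well defined and bounded on $\mathcal B_b(E)$, so that $e^{tA}=\sum_{n\ge0}\frac{t^n}{n!}A^n$ is well defined. Moreover there exist a quasi-stationary distribution $\alpha\in\mathcal M_1(E)$ (that is, $\mathbb P_\alpha(X_t\in\cdot\mid t<\tau_\partial)=\alpha$ for all $t\ge0$), a bounded measurable function $\eta:E\to[0,\infty)$ with $\alpha(\eta)=1$, constants $\lambda_0,\gamma,C>0$, and constants $C',C''$ such that, for all $t\ge0$, $x\in E$ and $\mu\in\mathcal M_1(E)$, $$(*)\quad \begin{aligned}&\mathbb P_\alpha(t<\tau_\partial)=e^{-\lambda_0t},&&\|\mathbb P_\mu(X_t\in\cdot\mid t<\tau_\partial)-\alpha\|_{TV}\le Ce^{-\gamma t},\\ &|e^{\lambda_0t}\mathbb P_x(t<\tau_\partial)-\eta(x)|\le C'e^{-\gamma t},&&\mathbb P_x(t<\tau_\partial)\le C''e^{-\lambda_0t}.\end{aligned}$$ For every such choice of $\alpha,\eta,\lambda_0,\gamma,C,C',C''$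 the following holds. For all $\mu\in\mathcal M_1(E)$, $f\in\mathcal B_b(E)$ and $n\ge1$, $$\left|\mu A^nf-\frac{\alpha(f)\,\mu(\eta)}{\lambda_0^n}\right|\le\frac{(CC''+C')\,\|f\|_\infty}{(\lambda_0+\gamma)^n}.$$ Moreover there is a constant $B$ such that, for all $\mu\in\mathcal M_1(E)$, $\mu(\eta)>0$ and $$\left\|\frac{\mu A^n}{\mu A^n\mathbf 1}-\alpha\right\|_{TV}\le\frac{B}{\mu(\eta)}\left(\frac{\lambda_0}{\lambda_0+\gamma}\right)^n\ \ (n\ge1),\qquad \left\|\frac{\mu e^{tA}}{\mu e^{tA}\mathbf 1}-\alpha\right\|_{TV}\le\frac{B}{\mu(\eta)}\,e^{-t\frac{\gamma}{\lambda_0(\lambda_0+\gamma)}}\ \ (t\ge0),$$ where the normalizing factors $\mu A^n\mathbf 1$ and $\mu e^{tA}\mathbf 1$ are positive. -/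

import Mathlib

open MeasureTheory ProbabilityTheory
open scoped NNReal ENNReal

noncomputable section

/-- The state space `E ∪ {∂}`, with the measurable structure of the disjoint union. -/
abbrev WithCemetery (E : Type*) := E ⊕ Unit

/-- The cemetery point `∂`. -/
abbrev cemetery {E : Type*} : WithCemetery E := Sum.inr ()

/-- The absorption time `τ_∂ = inf {t ≥ 0 : X_t = ∂}`, with `inf ∅ = ∞`. -/
def absorptionTime {E Ω : Type*} (X : ℝ≥0 → Ω → WithCemetery E) (ω : Ω) : ℝ≥0∞ :=
  ⨅ (t : ℝ≥0) (_ : X t ω = cemetery), (t : ℝ≥0∞)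

/-- A time-homogeneous Markov process on `E ∪ {∂}`, absorbed in `∂` at time `τ_∂`. -/
structure AbsorbedMarkovProcess (E Ω : Type*) [MeasurableSpace E] [mΩ : MeasurableSpace Ω] where
  /-- the process `(X_t)_{t ≥ 0}` -/
  X : ℝ≥0 → Ω → WithCemetery E
  /-- the filtration with respect to which it is Markov -/
  ℱ : Filtration ℝ≥0 mΩ
  /-- the family `(ℙ_x)`, `x ∈ E ∪ {∂}`, depending measurably on `x` -/
  law : Kernel (WithCemetery E) Ω
  isMarkovKernel : IsMarkovKernel law
  measurable : Measurable (fun p : ℝ≥0 × Ω => X p.1 p.2)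
  adapted : ∀ t, Measurable[ℱ t] (X t)
  /-- under `ℙ_x` the law of `X_0` is `δ_x` -/
  start : ∀ x, (law x).map (X 0) = Measure.dirac x
  /-- `ℙ_x(X_{t+s} ∈ B | ℱ_t) = ℙ_{X_t}(X_s ∈ B)`, `ℙ_x`-almost surely -/
  markov : ∀ (x : WithCemetery E) (t s : ℝ≥0) (F : Set Ω) (B : Set (WithCemetery E)),
    MeasurableSet[ℱ t] F → MeasurableSet B →
      law x (F ∩ X (t + s) ⁻¹' B) = ∫⁻ ω in F, law (X t ω) (X s ⁻¹' B) ∂(law x)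
  /-- from time `τ_∂` on, the process stays in `∂`, almost surely for every initial law `m`
  (not only for every starting point, as the event in question need not be measurable) -/
  absorbed : ∀ m : Measure (WithCemetery E), IsProbabilityMeasure m →
    ∀ᵐ ω ∂(m.bind law), ∀ t : ℝ≥0, absorptionTime X ω ≤ t → X t ω = cemetery

/-- `f ∈ 𝓑_b(E)`: bounded and measurable. -/
def IsBddMeas {E : Type*} [MeasurableSpace E] (f : E → ℝ) : Prop :=
  Measurable f ∧ ∃ M : ℝ, ∀ x, |f x| ≤ M

/-- `‖f‖_∞`, for bounded `f`. -/
def supNorm {E : Type*} (f : E → ℝ) : ℝ := ⨆ x, |f x|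

/-- `‖μ₁ - μ₂‖_TV = sup {|μ₁(f) - μ₂(f)| : f ∈ 𝓑_b(E), ‖f‖_∞ ≤ 1}`, a finite signed measure being
given by the linear form `f ↦ μ(f)`. The supremum is taken in `[0, ∞]`. -/
def tvDist {E : Type*} [MeasurableSpace E] (Φ Ψ : (E → ℝ) → ℝ) : ℝ≥0∞ :=
  ⨆ (f : E → ℝ) (_ : Measurable f ∧ ∀ x, |f x| ≤ 1), ENNReal.ofReal |Φ f - Ψ f|

/-- The linear form `f ↦ μ(f)`. -/
def toForm {E : Type*} [MeasurableSpace E] (μ : Measure E) (f : E → ℝ) : ℝ := ∫ x, f x ∂μ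

namespace AbsorbedMarkovProcess

variable {E Ω : Type*} [MeasurableSpace E] [MeasurableSpace Ω] (𝕏 : AbsorbedMarkovProcess E Ω)

/-- `τ_∂` -/
def τ (ω : Ω) : ℝ≥0∞ := absorptionTime 𝕏.X ω

/-- `ℙ_x` for `x ∈ E` -/
def pr (x : E) : Measure Ω := 𝕏.law (Sum.inl x)

/-- `ℙ_μ = ∫ ℙ_x μ(dx)` for a measure `μ` on `E` -/
def prInit (μ : Measure E) : Measure Ω := (μ.map Sum.inl).bind 𝕏.law

/-- `Q(t < τ_∂)` -/
def survival (Q : Measure Ω) (t : ℝ≥0) : ℝ := Q.real {ω | (t : ℝ≥0∞) < 𝕏.τ ω}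

/-- The measure `Q(X_t ∈ · | t < τ_∂)` on `E`. -/
def condLaw (Q : Measure Ω) (t : ℝ≥0) : Measure E :=
  ((ProbabilityTheory.cond Q {ω | (t : ℝ≥0∞) < 𝕏.τ ω}).map (𝕏.X t)).comap Sum.inl

/-- `α` is a quasi-stationary distribution. -/
def IsQuasiStationary (α : Measure E) : Prop :=
  IsProbabilityMeasure α ∧ ∀ t, 𝕏.condLaw (𝕏.prInit α) t = α

/-- `P_t f(x) = 𝔼_x[f(X_t) 1_{t < τ_∂}]`. -/
def semigroup (t : ℝ≥0) (f : E → ℝ) (x : E) : ℝ :=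
  ∫ ω, Set.indicator {ω | (t : ℝ≥0∞) < 𝕏.τ ω} (fun ω => Sum.elim f (fun _ => 0) (𝕏.X t ω)) ω
    ∂(𝕏.pr x)

/-- The Green operator `A f(x) = ∫_0^∞ P_s f(x) ds`. -/
def green (f : E → ℝ) (x : E) : ℝ :=
  ∫ s in Set.Ioi (0 : ℝ), 𝕏.semigroup s.toNNReal f x

/-- `μ A^n f` -/
def greenPow (μ : Measure E) (n : ℕ) (f : E → ℝ) : ℝ := ∫ x, (𝕏.green^[n] f) x ∂μ

/-- `e^{tA} f(x) = ∑_n t^n / n! A^n f(x)` -/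
def expGreen (t : ℝ) (f : E → ℝ) (x : E) : ℝ :=
  ∑' n : ℕ, t ^ n / (n.factorial : ℝ) * (𝕏.green^[n] f) x

/-- `μ e^{tA} f` -/
def greenExp (μ : Measure E) (t : ℝ) (f : E → ℝ) : ℝ := ∫ x, 𝕏.expGreen t f x ∂μ

/-- Condition (A1) for `ν, t₀, c₁`: `ℙ_x(X_{t₀} ∈ · | t₀ < τ_∂) ≥ c₁ ν` for all `x ∈ E`. -/
def CondA1 (ν : Measure E) (t₀ : ℝ≥0) (c₁ : ℝ) : Prop :=
  ∀ x, ENNReal.ofReal c₁ • ν ≤ 𝕏.condLaw (𝕏.pr x) t₀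

/-- Condition (A2) for `ν, c₂`: `ℙ_ν(t < τ_∂) ≥ c₂ ℙ_x(t < τ_∂)` for all `t ≥ 0`, `x ∈ E`. -/
def CondA2 (ν : Measure E) (c₂ : ℝ) : Prop :=
  ∀ t x, c₂ * 𝕏.survival (𝕏.pr x) t ≤ 𝕏.survival (𝕏.prInit ν) t

/-- The relations that say what the quasi-stationary distribution `α`, the absorption rate `lam`
(`λ₀`), the function `η` and the constants `γ, C, C', C''` are. -/
structure IsSpectralData (α : Measure E) (η : E → ℝ) (lam γ C C' C'' : ℝ) : Prop where
  quasiStationary : 𝕏.IsQuasiStationary α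
  lam_pos : 0 < lam
  survival_eq : ∀ t : ℝ≥0, 𝕏.survival (𝕏.prInit α) t = Real.exp (-lam * t)
  C_pos : 0 < C
  γ_pos : 0 < γ
  tv_le : ∀ μ : Measure E, IsProbabilityMeasure μ → ∀ t : ℝ≥0,
    tvDist (toForm (𝕏.condLaw (𝕏.prInit μ) t)) (toForm α) ≤ ENNReal.ofReal (C * Real.exp (-γ * t))
  η_bddMeas : IsBddMeas η
  η_nonneg : ∀ x, 0 ≤ η x
  η_integral : ∫ x, η x ∂α = 1
  η_approx : ∀ (x : E) (t : ℝ≥0),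
    |Real.exp (lam * t) * 𝕏.survival (𝕏.pr x) t - η x| ≤ C' * Real.exp (-γ * t)
  survival_le : ∀ (x : E) (t : ℝ≥0), 𝕏.survival (𝕏.pr x) t ≤ C'' * Real.exp (-lam * t)

end AbsorbedMarkovProcess

end

/-!
Over each period `t₀`, conditions (A1) and (A2) shrink the oscillation of `P_t f / P_t 1` by the
factor `1 - c₁ c₂`, so the laws conditioned on survival forget their initial law exponentially fast
in total variation. They are therefore Cauchy; their limit `α` is quasi-stationary, so its survival
probability is multiplicative in time and equals `e^{-λ₀ t}`. The same estimate makes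
`e^{λ₀ t} P_t 1` a Cauchy family, with limit `η`.

As `P_t f` is `P_t 1` times the conditional mean of `f`, it differs from `e^{-λ₀ t} α(f) η` by at
most `R e^{-(λ₀ + γ) t}`, where `R = (C C'' + C') ‖f‖`. The Green operator `A` commutes with `P_t`
and preserves estimates of this form: integration over `[t, ∞)` divides the main term by `λ₀` and
the error by `λ₀ + γ`. Iterating gives the estimate for `A^n`, and summing the exponential series
the one for `e^{tA}`. The normalized functionals follow by division, since the main term for `f`
is `α(f)` times the main term for `1`.
-/

noncomputable section

open Filter Topology

section SupNorm

variable {E : Type*} {f g : E → ℝ}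

lemma supNorm_nonneg (f : E → ℝ) : 0 ≤ supNorm f := Real.iSup_nonneg fun _ => abs_nonneg _

lemma supNorm_le_mul_supNorm {c : ℝ} (h : ∀ x, |f x| ≤ c * supNorm g) :
    supNorm f ≤ c * supNorm g := by
  cases isEmpty_or_nonempty E with
  | inl _ => simp [supNorm]
  | inr _ => exact ciSup_le h

end SupNorm

namespace IsBddMeas

variable {E : Type*} [MeasurableSpace E] {f g : E → ℝ}

lemma integrable (hf : IsBddMeas f) (μ : Measure E) [IsFiniteMeasure μ] : Integrable f μ := by
  obtain ⟨hm, M, hM⟩ := hf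
  exact Integrable.of_bound hm.aestronglyMeasurable M (Eventually.of_forall hM)

lemma const (c : ℝ) : IsBddMeas (fun _ : E => c) := ⟨measurable_const, |c|, fun _ => le_rfl⟩

lemma one : IsBddMeas (1 : E → ℝ) := const 1

lemma sub (hf : IsBddMeas f) (hg : IsBddMeas g) : IsBddMeas (fun x => f x - g x) := by
  obtain ⟨hfm, M, hM⟩ := hf
  obtain ⟨hgm, M', hM'⟩ := hg
  exact ⟨hfm.sub hgm, M + M', fun x => (abs_sub _ _).trans (add_le_add (hM x) (hM' x))⟩

lemma const_mul (c : ℝ) (hf : IsBddMeas f) : IsBddMeas (fun x => c * f x) := by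
  obtain ⟨hm, M, hM⟩ := hf
  refine ⟨hm.const_mul c, |c| * M, fun x => ?_⟩
  rw [abs_mul]
  exact mul_le_mul_of_nonneg_left (hM x) (abs_nonneg _)

lemma indicator_one {B : Set E} (hB : MeasurableSet B) : IsBddMeas (B.indicator (1 : E → ℝ)) :=
  ⟨measurable_one.indicator hB, 1, fun x => by by_cases h : x ∈ B <;> simp [h]⟩

lemma abs_le_supNorm (hf : IsBddMeas f) (x : E) : |f x| ≤ supNorm f := by
  obtain ⟨-, M, hM⟩ := hf
  exact le_ciSup (f := fun x => |f x|) ⟨M, Set.forall_mem_range.2 hM⟩ x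

lemma abs_integral_le_supNorm (hf : IsBddMeas f) (μ : Measure E) [IsProbabilityMeasure μ] :
    |∫ x, f x ∂μ| ≤ supNorm f := by
  simpa using norm_integral_le_of_norm_le_const (μ := μ) (f := f)
    (Eventually.of_forall hf.abs_le_supNorm)

lemma integral_pos (hf : IsBddMeas f) (hpos : ∀ x, 0 < f x) (μ : Measure E)
    [IsProbabilityMeasure μ] : 0 < ∫ x, f x ∂μ := by
  rw [integral_pos_iff_support_of_nonneg (fun x => (hpos x).le) (hf.integrable μ)]
  simp [Function.support_eq_univ fun x => (hpos x).ne']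

lemma abs_integral_sub_mul_integral_le (hf : IsBddMeas f) (hg : IsBddMeas g) (μ : Measure E)
    [IsProbabilityMeasure μ] {c r : ℝ} (h : ∀ x, |f x - c * g x| ≤ r) :
    |∫ x, f x ∂μ - c * ∫ x, g x ∂μ| ≤ r := by
  rw [← integral_const_mul, ← integral_sub (hf.integrable μ) ((hg.const_mul c).integrable μ)]
  simpa using norm_integral_le_of_norm_le_const (μ := μ) (f := fun x => f x - c * g x)
    (Eventually.of_forall h)

end IsBddMeas

section TotalVariation

variable {E : Type*} [MeasurableSpace E] {Φ Ψ : (E → ℝ) → ℝ} {μ α : Measure E}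

lemma tvDist_le_ofReal_iff {r : ℝ} (hr : 0 ≤ r) : tvDist Φ Ψ ≤ ENNReal.ofReal r ↔
    ∀ f : E → ℝ, Measurable f → (∀ x, |f x| ≤ 1) → |Φ f - Ψ f| ≤ r := by
  simp only [tvDist, iSup_le_iff, ENNReal.ofReal_le_ofReal_iff hr, and_imp]

lemma abs_integral_sub_le_of_tvDist_le {r : ℝ} (hr : 0 ≤ r)
    (h : tvDist (toForm μ) (toForm α) ≤ ENNReal.ofReal r) {f : E → ℝ} (hf : IsBddMeas f) :
    |∫ x, f x ∂μ - ∫ x, f x ∂α| ≤ supNorm f * r := by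
  have hle := hf.abs_le_supNorm
  rcases (supNorm_nonneg f).eq_or_lt with h0 | h0
  · have hf0 : f = 0 := funext fun x => abs_nonpos_iff.1 (h0 ▸ hle x)
    simpa [hf0] using mul_nonneg (supNorm_nonneg 0) hr
  · have key := (tvDist_le_ofReal_iff hr).1 h (fun x => (supNorm f)⁻¹ * f x)
      (hf.1.const_mul _) fun x => by
        rw [abs_mul, abs_of_pos (inv_pos.2 h0)]
        exact inv_mul_le_one_of_le₀ (hle x) h0.le
    rwa [toForm, toForm, integral_const_mul, integral_const_mul, ← mul_sub, abs_mul,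
      abs_of_pos (inv_pos.2 h0), inv_mul_le_iff₀ h0] at key

lemma abs_div_sub_le {p q a e r : ℝ} (hq : 0 < q) (he : 0 < e) (hpq : |p| ≤ q)
    (hp : |p - a * e| ≤ r) (hqe : |q - e| ≤ r) : |p / q - a| ≤ 2 * r / e := by
  have hratio : |p / q| ≤ 1 := by rwa [abs_div, abs_of_pos hq, div_le_one hq]
  rw [le_div_iff₀ he]
  calc |p / q - a| * e = |(p / q - a) * e| := by rw [abs_mul, abs_of_pos he]
    _ = |p / q * (e - q) + (p - a * e)| := by congr 1; field_simp; ring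
    _ ≤ |p / q| * |e - q| + |p - a * e| := (abs_add_le _ _).trans_eq (by rw [abs_mul])
    _ ≤ 1 * r + r := by rw [abs_sub_comm e q]; gcongr
    _ = 2 * r := by ring

lemma tvDist_div_le [IsProbabilityMeasure α] {e r : ℝ} (he : 0 < e) (hone : 0 < Φ 1)
    (hle : ∀ f, Measurable f → (∀ x, |f x| ≤ 1) → |Φ f| ≤ Φ 1)
    (happrox : ∀ f, Measurable f → (∀ x, |f x| ≤ 1) → |Φ f - (∫ x, f x ∂α) * e| ≤ r) :
    tvDist (fun f => Φ f / Φ 1) (toForm α) ≤ ENNReal.ofReal (2 * r / e) := by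
  have hΦe : |Φ 1 - e| ≤ r := by simpa using happrox 1 measurable_one (by simp)
  have hr : 0 ≤ r := (abs_nonneg _).trans hΦe
  exact (tvDist_le_ofReal_iff (by positivity)).2 fun f hf hf1 =>
    abs_div_sub_le hone he (hle f hf hf1) (happrox f hf hf1) hΦe

lemma tvDist_integral_div_le [IsProbabilityMeasure μ] [IsProbabilityMeasure α]
    {T : (E → ℝ) → E → ℝ} {η : E → ℝ} {p r : ℝ} (hp : 0 < p) (hη : IsBddMeas η)
    (hη0 : 0 < ∫ x, η x ∂μ) (hT : ∀ f, IsBddMeas f → IsBddMeas (T f)) (hone : ∀ x, 0 < T 1 x)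
    (hle : ∀ f, IsBddMeas f → (∀ x, |f x| ≤ 1) → ∀ x, |T f x| ≤ T 1 x)
    (happrox : ∀ f, IsBddMeas f → (∀ x, |f x| ≤ 1) → ∀ x,
      |T f x - (∫ y, f y ∂α) * p * η x| ≤ r) :
    tvDist (fun f => (∫ x, T f x ∂μ) / ∫ x, T 1 x ∂μ) (toForm α) ≤
      ENNReal.ofReal (2 * r / (p * ∫ x, η x ∂μ)) := by
  refine tvDist_div_le (Φ := fun f => ∫ x, T f x ∂μ) (mul_pos hp hη0)
    ((hT 1 .one).integral_pos hone μ) (fun f hf hf1 => ?_) fun f hf hf1 => ?_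
  · exact norm_integral_le_of_norm_le (f := T f) ((hT 1 .one).integrable μ)
      (Eventually.of_forall (hle f ⟨hf, 1, hf1⟩ hf1))
  · have hfb : IsBddMeas f := ⟨hf, 1, hf1⟩
    rw [← mul_assoc]
    exact (hT f hfb).abs_integral_sub_mul_integral_le hη μ (happrox f hfb hf1)

end TotalVariation

section SetwiseLimits

variable {E ι : Type*} [MeasurableSpace E] {l : Filter ι} {Q : ι → Measure E}
  {L : Set E → ℝ}

lemma hasSum_of_tendstoUniformlyOn_measureReal [l.NeBot]
    [∀ i, IsFiniteMeasure (Q i)]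
    (hL : TendstoUniformlyOn (fun i B => (Q i).real B) L l {B | MeasurableSet B})
    {B : ℕ → Set E} (hB : ∀ n, MeasurableSet (B n)) (hd : Pairwise (Function.onFun Disjoint B)) :
    HasSum (fun n => L (B n)) (L (⋃ n, B n)) := by
  have hmeas (s : Finset ℕ) : MeasurableSet (⋃ n ∈ s, B n) :=
    s.measurableSet_biUnion fun n _ => hB n
  have hfin (s : Finset ℕ) : ∑ n ∈ s, L (B n) = L (⋃ n ∈ s, B n) := by
    refine tendsto_nhds_unique (tendsto_finsetSum s fun n _ => hL.tendsto_at (hB n)) ?_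
    refine (hL.tendsto_at (hmeas s)).congr fun i => ?_
    exact measureReal_biUnion_finset (fun _ _ _ _ hnm => hd hnm) fun n _ => hB n
  have hunif : TendstoUniformly (fun i (s : Finset ℕ) => (Q i).real (⋃ n ∈ s, B n))
      (fun s => L (⋃ n ∈ s, B n)) l := by
    rw [← tendstoUniformlyOn_univ]
    exact (hL.comp fun s : Finset ℕ => ⋃ n ∈ s, B n).mono fun s _ => hmeas s
  have hcont (i : ι) : Tendsto (fun s : Finset ℕ => (Q i).real (⋃ n ∈ s, B n)) atTop
      (𝓝 ((Q i).real (⋃ n, B n))) := by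
    rw [Set.iUnion_eq_iUnion_finset]
    refine (ENNReal.tendsto_toReal (measure_ne_top _ _)).comp (tendsto_measure_iUnion_atTop ?_)
    exact fun s t hst => Set.biUnion_subset_biUnion_left hst
  simp only [HasSum, hfin]
  exact hunif.tendsto_of_eventually_tendsto (Eventually.of_forall hcont)
    (hL.tendsto_at (.iUnion hB))

lemma exists_isProbabilityMeasure_of_tendstoUniformlyOn [l.NeBot]
    [∀ i, IsProbabilityMeasure (Q i)]
    (hL : TendstoUniformlyOn (fun i B => (Q i).real B) L l {B | MeasurableSet B}) :
    ∃ α : Measure E, IsProbabilityMeasure α ∧ ∀ B, MeasurableSet B → α.real B = L B := by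
  have hL_nonneg {B : Set E} (hB : MeasurableSet B) : 0 ≤ L B :=
    ge_of_tendsto' (hL.tendsto_at hB) fun i => measureReal_nonneg
  have hL_empty : L ∅ = 0 := tendsto_nhds_unique (hL.tendsto_at .empty) (by simp)
  have hL_univ : L Set.univ = 1 := tendsto_nhds_unique (hL.tendsto_at .univ) (by simp)
  let α : Measure E := Measure.ofMeasurable (fun B _ => ENNReal.ofReal (L B)) (by simp [hL_empty])
    fun B hB hd => by
      have hsum := hasSum_of_tendstoUniformlyOn_measureReal hL hB hd
      rw [← hsum.tsum_eq, ENNReal.ofReal_tsum_of_nonneg (fun n => hL_nonneg (hB n)) hsum.summable]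
  have hα {B : Set E} (hB : MeasurableSet B) : α B = ENNReal.ofReal (L B) :=
    Measure.ofMeasurable_apply B hB
  refine ⟨α, ⟨by simp [hα .univ, hL_univ]⟩, fun B hB => ?_⟩
  rw [measureReal_def, hα hB, ENNReal.toReal_ofReal (hL_nonneg hB)]

lemma tendsto_integral_of_tendsto_measureReal_of_nonneg [l.IsCountablyGenerated]
    [∀ i, IsProbabilityMeasure (Q i)] {α : Measure E} [IsProbabilityMeasure α]
    (hQ : ∀ B, MeasurableSet B → Tendsto (fun i => (Q i).real B) l (𝓝 (α.real B)))
    {f : E → ℝ} (hf : IsBddMeas f) (hf0 : ∀ x, 0 ≤ f x) :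
    Tendsto (fun i => ∫ x, f x ∂(Q i)) l (𝓝 (∫ x, f x ∂α)) := by
  obtain ⟨M, hM⟩ := hf.2
  have layercake (μ : Measure E) [IsProbabilityMeasure μ] :
      ∫ x, f x ∂μ = ∫ t in Set.Ioc 0 M, μ.real {a | t ≤ f a} :=
    (hf.integrable μ).integral_eq_integral_Ioc_meas_le (Eventually.of_forall hf0)
      (Eventually.of_forall fun x => (le_abs_self _).trans (hM x))
  simp only [layercake]
  refine tendsto_integral_filter_of_dominated_convergence (fun _ => 1)
    (Eventually.of_forall fun i => ?_)
    (Eventually.of_forall fun i => Eventually.of_forall fun t => ?_) (by simp)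
    (Eventually.of_forall fun t => hQ _ (measurableSet_le measurable_const hf.1))
  · refine (Antitone.measurable fun s t hst => ?_).aestronglyMeasurable
    exact measureReal_mono fun a (ha : t ≤ f a) => hst.trans ha
  · rw [Real.norm_of_nonneg measureReal_nonneg]
    exact measureReal_le_one

lemma tendsto_integral_of_tendsto_measureReal [l.IsCountablyGenerated]
    [∀ i, IsProbabilityMeasure (Q i)] {α : Measure E} [IsProbabilityMeasure α]
    (hQ : ∀ B, MeasurableSet B → Tendsto (fun i => (Q i).real B) l (𝓝 (α.real B)))
    {f : E → ℝ} (hf : IsBddMeas f) :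
    Tendsto (fun i => ∫ x, f x ∂(Q i)) l (𝓝 (∫ x, f x ∂α)) := by
  obtain ⟨M, hM⟩ := hf.2
  have hshift (μ : Measure E) [IsProbabilityMeasure μ] :
      ∫ x, f x ∂μ = ∫ x, f x - (-M) ∂μ - M := by
    rw [integral_sub (hf.integrable μ) (integrable_const _)]
    simp
  simp only [hshift]
  exact (tendsto_integral_of_tendsto_measureReal_of_nonneg hQ (hf.sub (.const _))
    fun x => by linarith [neg_abs_le (f x), hM x]).sub_const M

end SetwiseLimits

section ExponentialRates

lemma exists_abs_sub_le_of_abs_add_sub_le {h r : ℝ≥0 → ℝ} (hr : Tendsto r atTop (𝓝 0))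
    (hh : ∀ t u, |h (t + u) - h t| ≤ r t) : ∃ l, ∀ t, |h t - l| ≤ r t := by
  have hcauchy : CauchySeq h := cauchySeq_of_le_tendsto_0' r (fun t s hts => by
    obtain ⟨u, rfl⟩ := exists_add_of_le hts
    rw [dist_comm, Real.dist_eq]
    exact hh t u) hr
  obtain ⟨l, hl⟩ := cauchySeq_tendsto_of_complete hcauchy
  refine ⟨l, fun t => le_of_tendsto (hl.const_sub (h t)).abs ?_⟩
  filter_upwards [eventually_ge_atTop t] with s hts
  obtain ⟨u, rfl⟩ := exists_add_of_le hts
  rw [abs_sub_comm]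
  exact hh t u

lemma tendsto_mul_exp_neg_mul_atTop (C : ℝ) {γ : ℝ} (hγ : 0 < γ) :
    Tendsto (fun t : ℝ≥0 => C * Real.exp (-γ * t)) atTop (𝓝 0) := by
  rw [← mul_zero C]
  refine (Real.tendsto_exp_atBot.comp ?_).const_mul C
  exact NNReal.tendsto_coe_atTop.2 tendsto_id |>.const_mul_atTop_of_neg (neg_lt_zero.2 hγ)

lemma eq_mul_of_monotone_of_map_add {L : ℝ≥0 → ℝ} (hmono : Monotone L)
    (hadd : ∀ s t, L (s + t) = L s + L t) (t : ℝ≥0) : L t = t * L 1 := by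
  have hzero : L 0 = 0 := by simpa using hadd 0 0
  have hnat (n : ℕ) (s : ℝ≥0) : L (n * s) = n * L s := by
    simpa using map_nsmul (⟨⟨L, hzero⟩, hadd⟩ : ℝ≥0 →+ ℝ) n s
  have hnat_one (n : ℕ) : L n = n * L 1 := by simpa using hnat n 1
  have hlim := tendsto_natCast_atTop_atTop (R := ℝ)
  apply le_antisymm
  · refine ge_of_tendsto (((tendsto_nat_ceil_mul_div_atTop t.coe_nonneg).comp hlim).mul_const _) ?_
    filter_upwards [eventually_gt_atTop 0] with n hn
    have hceil : (n * t : ℝ≥0) ≤ ⌈(t : ℝ) * n⌉₊ := by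
      exact_mod_cast (mul_comm _ _).trans_le (Nat.le_ceil ((t : ℝ) * n))
    have hle := hmono hceil
    rw [hnat, hnat_one] at hle
    rwa [Function.comp_apply, div_mul_eq_mul_div, le_div_iff₀' (Nat.cast_pos.2 hn)]
  · refine le_of_tendsto (((tendsto_nat_floor_mul_div_atTop t.coe_nonneg).comp hlim).mul_const _) ?_
    filter_upwards [eventually_gt_atTop 0] with n hn
    have hfloor : (⌊(t : ℝ) * n⌋₊ : ℝ≥0) ≤ n * t := by
      exact_mod_cast (Nat.floor_le (by positivity)).trans_eq (mul_comm (t : ℝ) n)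
    have hle := hmono hfloor
    rw [hnat, hnat_one] at hle
    rwa [Function.comp_apply, div_mul_eq_mul_div, div_le_iff₀' (Nat.cast_pos.2 hn)]

lemma eq_exp_of_antitone_of_map_add_eq_mul {φ : ℝ≥0 → ℝ} (hpos : ∀ t, 0 < φ t)
    (hanti : Antitone φ) (hmul : ∀ s t, φ (s + t) = φ s * φ t) (t : ℝ≥0) :
    φ t = Real.exp (Real.log (φ 1) * t) := by
  have hlog := eq_mul_of_monotone_of_map_add (L := fun s => -Real.log (φ s))
    (fun s u hsu => neg_le_neg (Real.log_le_log (hpos u) (hanti hsu)))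
    (fun s u => by rw [hmul, Real.log_mul (hpos s).ne' (hpos u).ne', neg_add]) t
  rw [← Real.exp_log (hpos t)]
  congr 1
  linarith

lemma one_sub_pow_floor_le_exp {c : ℝ} (hc : 0 ≤ c) (hc1 : c ≤ 1) (s : ℝ≥0) :
    (1 - c) ^ ⌊s⌋₊ ≤ Real.exp c * Real.exp (-c * s) := by
  have hs : (s : ℝ) ≤ ⌊s⌋₊ + 1 := by exact_mod_cast (Nat.lt_floor_add_one s).le
  calc (1 - c) ^ ⌊s⌋₊ ≤ Real.exp (-c) ^ ⌊s⌋₊ :=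
        pow_le_pow_left₀ (sub_nonneg.2 hc1) (Real.one_sub_le_exp_neg c) _
    _ = Real.exp (⌊s⌋₊ * -c) := (Real.exp_nat_mul _ _).symm
    _ ≤ Real.exp (c + -c * s) := Real.exp_le_exp.2 (by nlinarith)
    _ = Real.exp c * Real.exp (-c * s) := Real.exp_add _ _

end ExponentialRates

/-- A jointly measurable semigroup of sub-Markov kernels. In the theorem `P_t(x, ·)` is the law of
`X_t` under `ℙ_x`, restricted to `t < τ_∂`. -/
structure SubMarkovSemigroup (E : Type*) [MeasurableSpace E] where
  /-- `(t, x) ↦ P_t(x, ·)` -/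
  P : Kernel (ℝ≥0 × E) E
  mass_le : ∀ p, P p Set.univ ≤ 1
  zero : ∀ x, P (0, x) = Measure.dirac x
  add : ∀ s t x, P (s + t, x) = (P (s, x)).bind fun y => P (t, y)

namespace SubMarkovSemigroup

section Basic

variable {E : Type*} [MeasurableSpace E] (S : SubMarkovSemigroup E)

instance : IsFiniteKernel S.P := ⟨⟨1, ENNReal.one_lt_top, S.mass_le⟩⟩

/-- The kernel `P_t` at a fixed time. -/
def kernel (t : ℝ≥0) : Kernel E E := S.P.comap (Prod.mk t) measurable_prodMk_left

instance (t : ℝ≥0) : IsFiniteKernel (S.kernel t) := by unfold kernel; infer_instance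

/-- The operator `f ↦ P_t f` on functions. -/
def op (t : ℝ≥0) (f : E → ℝ) (x : E) : ℝ := ∫ y, f y ∂(S.P (t, x))

/-- The survival probability `P_t 1`. -/
def survival (t : ℝ≥0) : E → ℝ := S.op t 1

lemma survival_eq_measureReal (t : ℝ≥0) (x : E) :
    S.survival t x = (S.P (t, x)).real Set.univ := by
  simp [survival, op]

lemma survival_nonneg (t : ℝ≥0) (x : E) : 0 ≤ S.survival t x := by
  rw [survival_eq_measureReal]
  exact measureReal_nonneg

lemma survival_le_one (t : ℝ≥0) (x : E) : S.survival t x ≤ 1 := by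
  rw [survival_eq_measureReal]
  exact ENNReal.toReal_le_of_le_ofReal zero_le_one (by simpa using S.mass_le _)

lemma measurable_op_uncurry {f : E → ℝ} (hf : Measurable f) :
    Measurable fun p : ℝ≥0 × E => S.op p.1 f p.2 :=
  (hf.stronglyMeasurable.integral_kernel (κ := S.P)).measurable

lemma measurable_op {f : E → ℝ} (hf : Measurable f) (t : ℝ≥0) : Measurable (S.op t f) :=
  (S.measurable_op_uncurry hf).comp measurable_prodMk_left

lemma op_mono {f g : E → ℝ} (hf : IsBddMeas f) (hg : IsBddMeas g) (h : ∀ x, f x ≤ g x)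
    (t : ℝ≥0) (x : E) : S.op t f x ≤ S.op t g x :=
  integral_mono (hf.integrable _) (hg.integrable _) h

lemma op_const (c : ℝ) (t : ℝ≥0) (x : E) : S.op t (fun _ => c) x = c * S.survival t x := by
  simp [op, survival_eq_measureReal, mul_comm]

lemma op_const_mul (c : ℝ) (f : E → ℝ) (t : ℝ≥0) (x : E) :
    S.op t (fun y => c * f y) x = c * S.op t f x := integral_const_mul _ _

lemma op_sub {f g : E → ℝ} (hf : IsBddMeas f) (hg : IsBddMeas g) (t : ℝ≥0) (x : E) :
    S.op t (fun y => f y - g y) x = S.op t f x - S.op t g x :=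
  integral_sub (hf.integrable _) (hg.integrable _)

lemma abs_op_le {f : E → ℝ} {M : ℝ} (hM : ∀ x, |f x| ≤ M) (t : ℝ≥0) (x : E) :
    |S.op t f x| ≤ M * S.survival t x := by
  rw [survival_eq_measureReal]
  exact norm_integral_le_of_norm_le_const (f := f) (Eventually.of_forall hM)

lemma isBddMeas_op {f : E → ℝ} (hf : IsBddMeas f) (t : ℝ≥0) : IsBddMeas (S.op t f) := by
  obtain ⟨M, hM⟩ := hf.2
  refine ⟨S.measurable_op hf.1 t, M, fun x => (S.abs_op_le hM t x).trans ?_⟩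
  exact mul_le_of_le_one_right ((abs_nonneg _).trans (hM x)) (S.survival_le_one t x)

lemma isBddMeas_survival (t : ℝ≥0) : IsBddMeas (S.survival t) := S.isBddMeas_op .one t

lemma op_zero {f : E → ℝ} (hf : Measurable f) : S.op 0 f = f := by
  ext x
  rw [op, S.zero, integral_dirac' f x hf.stronglyMeasurable]

lemma survival_zero : S.survival 0 = 1 := S.op_zero measurable_one

/-- The measure `μ P_t`. -/
def push (μ : Measure E) (t : ℝ≥0) : Measure E := μ.bind (S.kernel t)

instance (μ : Measure E) [IsFiniteMeasure μ] (t : ℝ≥0) : IsFiniteMeasure (S.push μ t) := by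
  unfold push; infer_instance

lemma integral_push (μ : Measure E) [IsFiniteMeasure μ] (t : ℝ≥0) {f : E → ℝ}
    (hf : IsBddMeas f) : ∫ x, f x ∂(S.push μ t) = ∫ x, S.op t f x ∂μ := by
  have hcomp := Kernel.integral_comp (κ := Kernel.const Unit μ) (η := S.kernel t) (a := ())
    (f := f) (by
      have : IsFiniteMeasure ((S.kernel t ∘ₖ Kernel.const Unit μ) ()) := inferInstance
      exact hf.integrable _)
  rwa [← Measure.comp_eq_comp_const_apply] at hcomp

lemma push_real_univ (μ : Measure E) [IsFiniteMeasure μ] (t : ℝ≥0) :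
    (S.push μ t).real Set.univ = ∫ x, S.survival t x ∂μ := by
  simpa [survival] using S.integral_push μ t .one

lemma push_add (μ : Measure E) (s t : ℝ≥0) : S.push μ (s + t) = S.push (S.push μ s) t := by
  rw [push, push, push, Measure.bind_bind (S.kernel s).aemeasurable (S.kernel t).aemeasurable]
  exact congrArg μ.bind (funext (S.add s t))

lemma op_add {f : E → ℝ} (hf : IsBddMeas f) (s t : ℝ≥0) (x : E) :
    S.op (s + t) f x = S.op s (S.op t f) x := by
  rw [op, S.add]
  exact S.integral_push (S.P (s, x)) t hf

lemma survival_add (s t : ℝ≥0) (x : E) : S.survival (s + t) x = S.op s (S.survival t) x :=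
  S.op_add .one s t x

lemma survival_antitone (x : E) : Antitone fun t => S.survival t x := by
  intro s t hst
  obtain ⟨u, rfl⟩ := exists_add_of_le hst
  simp only [survival_add]
  exact S.op_mono (S.isBddMeas_survival u) .one (S.survival_le_one u) s x

end Basic

section CondLaw

variable {E : Type*} [MeasurableSpace E] (S : SubMarkovSemigroup E)

/-- The law at time `t` conditioned on survival, for the initial law `μ`; it is `0` if survival up
to time `t` has probability `0`. -/
def condLaw (μ : Measure E) (t : ℝ≥0) : Measure E := (S.push μ t Set.univ)⁻¹ • S.push μ t

lemma integral_op_eq (μ : Measure E) [IsFiniteMeasure μ] (t : ℝ≥0) {f : E → ℝ}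
    (hf : IsBddMeas f) :
    ∫ x, S.op t f x ∂μ = (∫ x, S.survival t x ∂μ) * ∫ x, f x ∂(S.condLaw μ t) := by
  rw [← push_real_univ, ← S.integral_push μ t hf, ← smul_eq_mul]
  exact (measure_smul_average _ _).symm

lemma op_eq_survival_mul (t : ℝ≥0) {f : E → ℝ} (hf : IsBddMeas f) (x : E) :
    S.op t f x = S.survival t x * ∫ y, f y ∂(S.condLaw (Measure.dirac x) t) := by
  have h := S.integral_op_eq (Measure.dirac x) t hf
  rwa [integral_dirac' _ _ (S.measurable_op hf.1 t).stronglyMeasurable,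
    integral_dirac' _ _ (S.isBddMeas_survival t).1.stronglyMeasurable] at h

lemma condLaw_smul {c : ℝ≥0∞} (hc₀ : c ≠ 0) (hc : c ≠ ∞) (μ : Measure E) (t : ℝ≥0) :
    S.condLaw (c • μ) t = S.condLaw μ t := by
  have hpush : S.push (c • μ) t = c • S.push μ t := Measure.bind_smul c μ _
  rw [condLaw, hpush, Measure.smul_apply, smul_eq_mul, ENNReal.mul_inv (.inl hc₀) (.inl hc),
    smul_smul, mul_right_comm, ENNReal.inv_mul_cancel hc₀ hc, one_mul, condLaw]

variable {S}

lemma push_univ_ne_zero (hpos : ∀ t x, 0 < S.survival t x) (μ : Measure E)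
    [IsProbabilityMeasure μ] (t : ℝ≥0) : S.push μ t Set.univ ≠ 0 := by
  rw [← measureReal_ne_zero_iff, push_real_univ]
  exact ((S.isBddMeas_survival t).integral_pos (hpos t) μ).ne'

lemma isProbabilityMeasure_condLaw (hpos : ∀ t x, 0 < S.survival t x) (μ : Measure E)
    [IsProbabilityMeasure μ] (t : ℝ≥0) : IsProbabilityMeasure (S.condLaw μ t) := by
  refine ⟨?_⟩
  rw [condLaw, Measure.smul_apply, smul_eq_mul,
    ENNReal.inv_mul_cancel (push_univ_ne_zero hpos μ t) (measure_ne_top _ _)]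

lemma condLaw_add (hpos : ∀ t x, 0 < S.survival t x) (μ : Measure E) [IsProbabilityMeasure μ]
    (s t : ℝ≥0) : S.condLaw μ (s + t) = S.condLaw (S.condLaw μ s) t := by
  have hs := push_univ_ne_zero hpos μ s
  rw [condLaw, push_add, ← condLaw, ← S.condLaw_smul (ENNReal.inv_ne_zero.2 (measure_ne_top _ _))
    (ENNReal.inv_ne_top.2 hs), ← condLaw]

lemma integral_condLaw_mem_Icc (hpos : ∀ t x, 0 < S.survival t x) (μ : Measure E)
    [IsProbabilityMeasure μ] {f : E → ℝ}
    (hf : IsBddMeas f) {t : ℝ≥0} {a b : ℝ}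
    (h : ∀ x, S.op t f x ∈ Set.Icc (a * S.survival t x) (b * S.survival t x)) :
    ∫ x, f x ∂(S.condLaw μ t) ∈ Set.Icc a b := by
  have hsurv := S.isBddMeas_survival t
  have hop := (S.isBddMeas_op hf t).integrable μ
  have hN : 0 < ∫ x, S.survival t x ∂μ := hsurv.integral_pos (hpos t) μ
  have hlow := integral_mono ((hsurv.const_mul a).integrable μ) hop fun x => (h x).1
  have hupp := integral_mono hop ((hsurv.const_mul b).integrable μ) fun x => (h x).2
  rw [integral_const_mul, S.integral_op_eq μ t hf, mul_comm] at hlow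
  rw [integral_const_mul, S.integral_op_eq μ t hf, mul_comm b] at hupp
  exact ⟨le_of_mul_le_mul_left hlow hN, le_of_mul_le_mul_left hupp hN⟩

end CondLaw

/-- Exponential forgetting of the initial law by the conditioned laws, uniformly in total
variation. -/
structure ForgetsInitialLaw {E : Type*} [MeasurableSpace E] (S : SubMarkovSemigroup E)
    (C γ : ℝ) : Prop where
  C_pos : 0 < C
  γ_pos : 0 < γ
  tvDist_condLaw_le : ∀ (μ₁ μ₂ : Measure E) [IsProbabilityMeasure μ₁] [IsProbabilityMeasure μ₂]
    (t : ℝ≥0), tvDist (toForm (S.condLaw μ₁ t)) (toForm (S.condLaw μ₂ t)) ≤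
      ENNReal.ofReal (C * Real.exp (-γ * t))

/-- Positivity of the survival probabilities together with conditions (A1) and (A2). -/
structure Doeblin {E : Type*} [MeasurableSpace E] (S : SubMarkovSemigroup E) (ν : Measure E)
    (t₀ : ℝ≥0) (c₁ c₂ : ℝ) : Prop where
  survival_pos : ∀ t x, 0 < S.survival t x
  prob : IsProbabilityMeasure ν
  t₀_pos : 0 < t₀
  c₁_pos : 0 < c₁
  c₂_pos : 0 < c₂
  minorization : ∀ x, ENNReal.ofReal c₁ • ν ≤ S.condLaw (Measure.dirac x) t₀
  survival_le : ∀ t x, c₂ * S.survival t x ≤ ∫ y, S.survival t y ∂ν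

namespace Doeblin

variable {E : Type*} [MeasurableSpace E] {S : SubMarkovSemigroup E} {ν : Measure E} {t₀ : ℝ≥0}
  {c₁ c₂ : ℝ}

lemma mul_integral_le_op (H : S.Doeblin ν t₀ c₁ c₂) {f : E → ℝ} (hf : IsBddMeas f)
    (hf0 : ∀ x, 0 ≤ f x) (x : E) : S.survival t₀ x * (c₁ * ∫ y, f y ∂ν) ≤ S.op t₀ f x := by
  have := isProbabilityMeasure_condLaw H.survival_pos (Measure.dirac x) t₀
  rw [S.op_eq_survival_mul t₀ hf]
  refine mul_le_mul_of_nonneg_left ?_ (S.survival_nonneg t₀ x)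
  have hmono := integral_mono_measure (H.minorization x) (Eventually.of_forall hf0)
    (hf.integrable _)
  rwa [integral_smul_measure, ENNReal.toReal_ofReal H.c₁_pos.le] at hmono

lemma mul_le_one (H : S.Doeblin ν t₀ c₁ c₂) : c₁ * c₂ ≤ 1 := by
  have := H.prob
  obtain ⟨x⟩ : Nonempty E := ν.nonempty_of_neZero
  have := isProbabilityMeasure_condLaw H.survival_pos (Measure.dirac x) t₀
  have hc₁ : c₁ ≤ 1 := by simpa using H.minorization x Set.univ
  have hc₂ : c₂ ≤ 1 := by simpa [survival_zero] using H.survival_le 0 x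
  exact mul_le_one₀ hc₁ H.c₂_pos.le hc₂

lemma survival_add_le (H : S.Doeblin ν t₀ c₁ c₂) (t : ℝ≥0) (x : E) :
    c₂ * S.survival (t₀ + t) x ≤ S.survival t₀ x * ∫ y, S.survival t y ∂ν := by
  have hmono := S.op_mono ((S.isBddMeas_survival t).const_mul c₂) (.const _) (H.survival_le t) t₀ x
  rwa [op_const_mul, ← survival_add, op_const, mul_comm (∫ y, _ ∂ν)] at hmono

lemma mul_integral_condLaw_mul_survival_le_op (H : S.Doeblin ν t₀ c₁ c₂) {t : ℝ≥0} {g : E → ℝ}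
    (hg : IsBddMeas g) (hg0 : ∀ x, 0 ≤ S.op t g x) (x : E) :
    c₁ * c₂ * (∫ y, g y ∂(S.condLaw ν t)) * S.survival (t₀ + t) x ≤ S.op (t₀ + t) g x := by
  have := H.prob
  have hN : 0 < ∫ y, S.survival t y ∂ν :=
    (S.isBddMeas_survival t).integral_pos (H.survival_pos t) ν
  have hop := S.integral_op_eq ν t hg
  have hm : 0 ≤ ∫ y, g y ∂(S.condLaw ν t) :=
    nonneg_of_mul_nonneg_right (hop ▸ integral_nonneg hg0) hN
  calc c₁ * c₂ * (∫ y, g y ∂(S.condLaw ν t)) * S.survival (t₀ + t) x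
      = c₁ * (∫ y, g y ∂(S.condLaw ν t)) * (c₂ * S.survival (t₀ + t) x) := by ring
    _ ≤ c₁ * (∫ y, g y ∂(S.condLaw ν t)) * (S.survival t₀ x * ∫ y, S.survival t y ∂ν) :=
        mul_le_mul_of_nonneg_left (H.survival_add_le t x) (mul_nonneg H.c₁_pos.le hm)
    _ = S.survival t₀ x * (c₁ * ∫ y, S.op t g y ∂ν) := by rw [hop]; ring
    _ ≤ S.op t₀ (S.op t g) x := H.mul_integral_le_op (S.isBddMeas_op hg t) hg0 x
    _ = S.op (t₀ + t) g x := (S.op_add hg t₀ t x).symm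

/-- The oscillation of `P_t f / P_t 1` shrinks by the factor `1 - c₁ c₂` over each period `t₀`:
the bound `mul_integral_condLaw_mul_survival_le_op` applies to both `f - a` and `b - f`. -/
lemma exists_Icc_contraction (H : S.Doeblin ν t₀ c₁ c₂) {t : ℝ≥0} {a b : ℝ} {f : E → ℝ}
    (hf : IsBddMeas f)
    (h : ∀ x, S.op t f x ∈ Set.Icc (a * S.survival t x) (b * S.survival t x)) :
    ∃ a' b', b' - a' = (1 - c₁ * c₂) * (b - a) ∧ ∀ x,
      S.op (t₀ + t) f x ∈ Set.Icc (a' * S.survival (t₀ + t) x) (b' * S.survival (t₀ + t) x) := by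
  have := H.prob
  have := isProbabilityMeasure_condLaw H.survival_pos ν t
  let m := ∫ y, f y ∂(S.condLaw ν t)
  have hopa (s : ℝ≥0) (x : E) : S.op s (fun y => f y - a) x = S.op s f x - a * S.survival s x := by
    rw [S.op_sub hf (.const a), op_const]
  have hopb (s : ℝ≥0) (x : E) : S.op s (fun y => b - f y) x = b * S.survival s x - S.op s f x := by
    rw [S.op_sub (.const b) hf, op_const]
  refine ⟨a + c₁ * c₂ * (m - a), b - c₁ * c₂ * (b - m), by ring, fun x => ⟨?_, ?_⟩⟩
  · have hlow := H.mul_integral_condLaw_mul_survival_le_op (hf.sub (.const a))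
      (fun y => by rw [hopa]; exact sub_nonneg.2 (h y).1) x
    rw [integral_sub (hf.integrable _) (integrable_const _), hopa] at hlow
    simp only [integral_const, probReal_univ, one_smul] at hlow
    linarith
  · have hupp := H.mul_integral_condLaw_mul_survival_le_op ((IsBddMeas.const b).sub hf)
      (fun y => by rw [hopb]; exact sub_nonneg.2 (h y).2) x
    rw [integral_sub (integrable_const _) (hf.integrable _), hopb] at hupp
    simp only [integral_const, probReal_univ, one_smul] at hupp
    linarith

lemma exists_Icc_iterate (H : S.Doeblin ν t₀ c₁ c₂) {f : E → ℝ} (hf : Measurable f)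
    (hf1 : ∀ x, |f x| ≤ 1) (n : ℕ) (u : ℝ≥0) :
    ∃ a b, b - a = 2 * (1 - c₁ * c₂) ^ n ∧ ∀ x, S.op (n * t₀ + u) f x ∈
      Set.Icc (a * S.survival (n * t₀ + u) x) (b * S.survival (n * t₀ + u) x) := by
  induction n with
  | zero =>
    refine ⟨-1, 1, by norm_num, fun x => ?_⟩
    rw [neg_mul, Set.mem_Icc, ← abs_le]
    exact S.abs_op_le hf1 _ x
  | succ n ih =>
    obtain ⟨a, b, hab, h⟩ := ih
    obtain ⟨a', b', hab', h'⟩ := H.exists_Icc_contraction ⟨hf, 1, hf1⟩ h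
    refine ⟨a', b', by rw [hab', hab, pow_succ]; ring, ?_⟩
    rwa [show ((n + 1 : ℕ) : ℝ≥0) * t₀ + u = t₀ + (n * t₀ + u) by push_cast; ring]

lemma forgetsInitialLaw (H : S.Doeblin ν t₀ c₁ c₂) :
    S.ForgetsInitialLaw (2 * Real.exp (c₁ * c₂)) (c₁ * c₂ / t₀) := by
  have hc : 0 < c₁ * c₂ := mul_pos H.c₁_pos H.c₂_pos
  have ht₀ : (0 : ℝ) < t₀ := H.t₀_pos
  refine ⟨by positivity, by positivity, fun μ₁ μ₂ _ _ t => ?_⟩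
  refine (tvDist_le_ofReal_iff (by positivity)).2 fun f hf hf1 => ?_
  obtain ⟨u, hu⟩ : ∃ u, t = ⌊t / t₀⌋₊ * t₀ + u :=
    exists_add_of_le ((le_div_iff₀ H.t₀_pos).1 (Nat.floor_le zero_le))
  obtain ⟨a, b, hab, hIcc⟩ := H.exists_Icc_iterate hf hf1 ⌊t / t₀⌋₊ u
  rw [← hu] at hIcc
  have h₁ := integral_condLaw_mem_Icc H.survival_pos μ₁ ⟨hf, 1, hf1⟩ hIcc
  have h₂ := integral_condLaw_mem_Icc H.survival_pos μ₂ ⟨hf, 1, hf1⟩ hIcc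
  calc |toForm (S.condLaw μ₁ t) f - toForm (S.condLaw μ₂ t) f|
      ≤ b - a := abs_sub_le_of_le_of_le h₁.1 h₁.2 h₂.1 h₂.2
    _ ≤ 2 * (Real.exp (c₁ * c₂) * Real.exp (-(c₁ * c₂) * ↑(t / t₀))) := by
        rw [hab]
        gcongr
        exact one_sub_pow_floor_le_exp hc.le H.mul_le_one _
    _ = 2 * Real.exp (c₁ * c₂) * Real.exp (-(c₁ * c₂ / t₀) * t) := by
        push_cast
        ring_nf

end Doeblin

variable {E : Type*} [MeasurableSpace E] {S : SubMarkovSemigroup E}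

/-- Quasi-stationarity of a probability measure `α`: conditionally on survival, the law at time `t`
from the initial law `α` is `α`. -/
structure IsQuasiStationary (S : SubMarkovSemigroup E) (α : Measure E) : Prop where
  prob : IsProbabilityMeasure α
  condLaw_eq : ∀ t, S.condLaw α t = α

lemma isQuasiStationary_of_tendsto_measureReal {ι : Type*} {l : Filter ι} [l.NeBot]
    [l.IsCountablyGenerated] (hpos : ∀ t x, 0 < S.survival t x) {Q : ι → Measure E}
    [∀ i, IsProbabilityMeasure (Q i)] {α : Measure E} [IsProbabilityMeasure α]
    (hQ : ∀ B, MeasurableSet B → Tendsto (fun i => (Q i).real B) l (𝓝 (α.real B)))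
    (hQt : ∀ t B, MeasurableSet B →
      Tendsto (fun i => (S.condLaw (Q i) t).real B) l (𝓝 (α.real B))) :
    S.IsQuasiStationary α := by
  refine ⟨inferInstance, fun t => Measure.ext fun B hB => ?_⟩
  have := isProbabilityMeasure_condLaw hpos α t
  have hB' := IsBddMeas.indicator_one hB
  have hop (μ : Measure E) [IsProbabilityMeasure μ] :
      ∫ x, S.op t (B.indicator 1) x ∂μ =
        (∫ x, S.survival t x ∂μ) * (S.condLaw μ t).real B := by
    rw [S.integral_op_eq μ t hB', integral_indicator_one hB]
  have hlim := tendsto_integral_of_tendsto_measureReal hQ (S.isBddMeas_op hB' t)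
  have hlim' := (tendsto_integral_of_tendsto_measureReal hQ (S.isBddMeas_survival t)).mul
    (hQt t B hB)
  simp only [hop] at hlim
  have hN : (∫ x, S.survival t x ∂α) ≠ 0 := ((S.isBddMeas_survival t).integral_pos (hpos t) α).ne'
  exact (measureReal_eq_measureReal_iff).1
    (mul_left_cancel₀ hN (tendsto_nhds_unique hlim hlim'))

namespace ForgetsInitialLaw

variable {C γ : ℝ}

lemma abs_measureReal_condLaw_sub_le (H : S.ForgetsInitialLaw C γ) (μ₁ μ₂ : Measure E)
    [IsProbabilityMeasure μ₁] [IsProbabilityMeasure μ₂] (t : ℝ≥0) {B : Set E}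
    (hB : MeasurableSet B) :
    |(S.condLaw μ₁ t).real B - (S.condLaw μ₂ t).real B| ≤ C * Real.exp (-γ * t) := by
  have hr : 0 ≤ C * Real.exp (-γ * t) := mul_nonneg H.C_pos.le (Real.exp_pos _).le
  have h := (tvDist_le_ofReal_iff hr).1 (H.tvDist_condLaw_le μ₁ μ₂ t) (B.indicator 1)
    (measurable_one.indicator hB) fun x => by by_cases hx : x ∈ B <;> simp [hx]
  rwa [toForm, toForm, integral_indicator_one hB, integral_indicator_one hB] at h

lemma exists_isQuasiStationary (H : S.ForgetsInitialLaw C γ) (hpos : ∀ t x, 0 < S.survival t x)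
    (ν : Measure E) [IsProbabilityMeasure ν] : ∃ α, S.IsQuasiStationary α := by
  have hprob (t : ℝ≥0) : IsProbabilityMeasure (S.condLaw ν t) :=
    isProbabilityMeasure_condLaw hpos ν t
  let r (t : ℝ≥0) : ℝ := C * Real.exp (-γ * t)
  have hr : Tendsto r atTop (𝓝 0) := tendsto_mul_exp_neg_mul_atTop C H.γ_pos
  have hstep (t u : ℝ≥0) {B : Set E} (hB : MeasurableSet B) :
      |(S.condLaw ν (t + u)).real B - (S.condLaw ν t).real B| ≤ r t := by
    rw [add_comm, condLaw_add hpos]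
    exact H.abs_measureReal_condLaw_sub_le _ ν t hB
  have hlim (B : Set E) : ∃ b, MeasurableSet B → ∀ t, |(S.condLaw ν t).real B - b| ≤ r t := by
    by_cases hB : MeasurableSet B
    · exact (exists_abs_sub_le_of_abs_add_sub_le hr fun t u => hstep t u hB).imp fun _ h _ => h
    · exact ⟨0, fun h => absurd h hB⟩
  choose L hL using hlim
  have hunif : TendstoUniformlyOn (fun t B => (S.condLaw ν t).real B) L atTop
      {B | MeasurableSet B} := by
    refine Metric.tendstoUniformlyOn_iff.2 fun ε hε => ?_
    filter_upwards [hr.eventually (gt_mem_nhds hε)] with t ht B hB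
    rw [dist_comm, Real.dist_eq]
    exact (hL B hB t).trans_lt ht
  obtain ⟨α, hα, hαL⟩ := exists_isProbabilityMeasure_of_tendstoUniformlyOn hunif
  have htendsto (B : Set E) (hB : MeasurableSet B) :
      Tendsto (fun t => (S.condLaw ν t).real B) atTop (𝓝 (α.real B)) :=
    hαL B hB ▸ hunif.tendsto_at hB
  refine ⟨α, isQuasiStationary_of_tendsto_measureReal hpos htendsto fun t B hB => ?_⟩
  simp only [← condLaw_add hpos]
  exact (htendsto B hB).comp (tendsto_atTop_mono (fun _ => le_self_add) tendsto_id)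

end ForgetsInitialLaw

namespace IsQuasiStationary

variable {α : Measure E}

lemma integral_op (hα : S.IsQuasiStationary α) {f : E → ℝ} (hf : IsBddMeas f) (t : ℝ≥0) :
    ∫ x, S.op t f x ∂α = (∫ x, S.survival t x ∂α) * ∫ x, f x ∂α := by
  have := hα.prob
  rw [S.integral_op_eq α t hf, hα.condLaw_eq]

lemma integral_survival_pos (hα : S.IsQuasiStationary α) (t : ℝ≥0) :
    0 < ∫ x, S.survival t x ∂α := by
  have := hα.prob
  refine (integral_nonneg (S.survival_nonneg t)).lt_of_ne' fun h0 => ?_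
  rw [← push_real_univ, measureReal_eq_zero_iff, Measure.measure_univ_eq_zero] at h0
  have hcond := hα.condLaw_eq t
  rw [condLaw, h0, smul_zero] at hcond
  exact IsProbabilityMeasure.ne_zero α hcond.symm

lemma exists_integral_survival_eq_exp (hα : S.IsQuasiStationary α)
    (hzero : ∀ x, Tendsto (fun t => S.survival t x) atTop (𝓝 0)) :
    ∃ lam : ℝ, 0 < lam ∧ ∀ t : ℝ≥0, ∫ x, S.survival t x ∂α = Real.exp (-lam * t) := by
  have := hα.prob
  let φ (t : ℝ≥0) : ℝ := ∫ x, S.survival t x ∂α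
  have hanti : Antitone φ := fun s t hst =>
    integral_mono ((S.isBddMeas_survival t).integrable α) ((S.isBddMeas_survival s).integrable α)
      fun x => S.survival_antitone x hst
  have hmul (s t : ℝ≥0) : φ (s + t) = φ s * φ t := by
    simp only [φ, survival_add]
    exact hα.integral_op (S.isBddMeas_survival t) s
  have hexp := eq_exp_of_antitone_of_map_add_eq_mul hα.integral_survival_pos hanti hmul
  have hφ : Tendsto φ atTop (𝓝 0) := by
    have hdom := tendsto_integral_filter_of_dominated_convergence (μ := α) (F := S.survival)
      (l := atTop) (f := fun _ => 0) (fun _ => 1)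
      (Eventually.of_forall fun t => (S.isBddMeas_survival t).1.aestronglyMeasurable)
      (Eventually.of_forall fun t => Eventually.of_forall fun x => by
        rw [Real.norm_of_nonneg (S.survival_nonneg t x)]; exact S.survival_le_one t x)
      (integrable_const _) (Eventually.of_forall hzero)
    simpa using hdom
  refine ⟨-Real.log (φ 1), ?_, fun t => by rw [neg_neg]; exact hexp t⟩
  by_contra! hlam
  refine absurd (ge_of_tendsto' hφ fun t => ?_) one_pos.not_ge
  exact (Real.one_le_exp (mul_nonneg (neg_nonpos.1 hlam) t.coe_nonneg)).trans_eq (hexp t).symm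

end IsQuasiStationary

namespace Doeblin

variable {ν α : Measure E} {t₀ : ℝ≥0} {c₁ c₂ : ℝ}

lemma mul_integral_le_integral (H : S.Doeblin ν t₀ c₁ c₂) (hα : S.IsQuasiStationary α)
    {f : E → ℝ} (hf : IsBddMeas f) (hf0 : ∀ x, 0 ≤ f x) :
    c₁ * ∫ x, f x ∂ν ≤ ∫ x, f x ∂α := by
  have := hα.prob
  have hmono := integral_mono (((S.isBddMeas_survival t₀).integrable α).mul_const _)
    ((S.isBddMeas_op hf t₀).integrable α) (H.mul_integral_le_op hf hf0)
  rw [integral_mul_const, hα.integral_op hf] at hmono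
  exact le_of_mul_le_mul_left hmono (hα.integral_survival_pos t₀)

lemma mul_survival_le_integral (H : S.Doeblin ν t₀ c₁ c₂) (hα : S.IsQuasiStationary α)
    (t : ℝ≥0) (x : E) : c₁ * c₂ * S.survival t x ≤ ∫ y, S.survival t y ∂α := by
  calc c₁ * c₂ * S.survival t x = c₁ * (c₂ * S.survival t x) := mul_assoc _ _ _
    _ ≤ c₁ * ∫ y, S.survival t y ∂ν :=
        mul_le_mul_of_nonneg_left (H.survival_le t x) H.c₁_pos.le
    _ ≤ ∫ y, S.survival t y ∂α :=
        H.mul_integral_le_integral hα (S.isBddMeas_survival t) (S.survival_nonneg t)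

end Doeblin

/-- Exponential decay of the survival probabilities, uniformly in the starting point. -/
structure ExpDecay (S : SubMarkovSemigroup E) (K lam : ℝ) : Prop where
  rate_pos : 0 < lam
  survival_le : ∀ (t : ℝ≥0) (x : E), S.survival t x ≤ K * Real.exp (-lam * t)

/-- The rescaled survival probability `e^{λt} P_t 1`, whose limit is `η`. -/
def scaledSurvival (S : SubMarkovSemigroup E) (lam : ℝ) (t : ℝ≥0) (x : E) : ℝ :=
  Real.exp (lam * t) * S.survival t x

lemma isBddMeas_scaledSurvival (lam : ℝ) (t : ℝ≥0) : IsBddMeas (S.scaledSurvival lam t) :=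
  (S.isBddMeas_survival t).const_mul _

lemma scaledSurvival_nonneg (lam : ℝ) (t : ℝ≥0) (x : E) : 0 ≤ S.scaledSurvival lam t x :=
  mul_nonneg (Real.exp_pos _).le (S.survival_nonneg t x)

lemma ExpDecay.scaledSurvival_le {K lam : ℝ} (D : S.ExpDecay K lam) (t : ℝ≥0) (x : E) :
    S.scaledSurvival lam t x ≤ K := by
  calc S.scaledSurvival lam t x ≤ Real.exp (lam * t) * (K * Real.exp (-lam * t)) :=
        mul_le_mul_of_nonneg_left (D.survival_le t x) (Real.exp_pos _).le
    _ = K := by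
        rw [mul_left_comm, ← Real.exp_add, neg_mul, add_neg_cancel, Real.exp_zero, mul_one]

lemma scaledSurvival_add (lam : ℝ) (t u : ℝ≥0) (x : E) :
    S.scaledSurvival lam (t + u) x = S.scaledSurvival lam t x *
      ∫ y, S.scaledSurvival lam u y ∂(S.condLaw (Measure.dirac x) t) := by
  simp only [scaledSurvival]
  rw [survival_add, S.op_eq_survival_mul t (S.isBddMeas_survival u), integral_const_mul,
    NNReal.coe_add, mul_add, Real.exp_add]
  ring

section RescaledLimit

variable {α : Measure E} {K lam : ℝ} {r : ℝ≥0 → ℝ}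

lemma integral_scaledSurvival
    (hα : ∀ t : ℝ≥0, ∫ x, S.survival t x ∂α = Real.exp (-lam * t)) (t : ℝ≥0) :
    ∫ x, S.scaledSurvival lam t x ∂α = 1 := by
  simp only [scaledSurvival]
  rw [integral_const_mul, hα, ← Real.exp_add, neg_mul, add_neg_cancel, Real.exp_zero]

lemma ExpDecay.abs_scaledSurvival_add_sub_le (D : S.ExpDecay K lam)
    (hα : ∀ t : ℝ≥0, ∫ x, S.survival t x ∂α = Real.exp (-lam * t)) (hr : ∀ t, 0 ≤ r t)
    (htv : ∀ x t, tvDist (toForm (S.condLaw (Measure.dirac x) t)) (toForm α) ≤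
      ENNReal.ofReal (r t)) (t u : ℝ≥0) (x : E) :
    |S.scaledSurvival lam (t + u) x - S.scaledSurvival lam t x| ≤ K * (K * r t) := by
  have : Nonempty E := ⟨x⟩
  have hK : supNorm (S.scaledSurvival lam u) ≤ K := ciSup_le fun y => by
    rw [abs_of_nonneg (S.scaledSurvival_nonneg lam u y)]
    exact D.scaledSurvival_le u y
  have hclose := abs_integral_sub_le_of_tvDist_le (hr t) (htv x t)
    (S.isBddMeas_scaledSurvival lam u)
  rw [integral_scaledSurvival hα] at hclose
  rw [scaledSurvival_add, ← mul_sub_one, abs_mul, abs_of_nonneg (S.scaledSurvival_nonneg lam t x)]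
  exact mul_le_mul (D.scaledSurvival_le t x)
    (hclose.trans (mul_le_mul_of_nonneg_right hK (hr t))) (abs_nonneg _)
    ((supNorm_nonneg _).trans hK)

lemma ExpDecay.exists_scaledSurvival_limit [IsProbabilityMeasure α] (D : S.ExpDecay K lam)
    (hα : ∀ t : ℝ≥0, ∫ x, S.survival t x ∂α = Real.exp (-lam * t)) (hr : ∀ t, 0 ≤ r t)
    (hr0 : Tendsto r atTop (𝓝 0))
    (htv : ∀ x t, tvDist (toForm (S.condLaw (Measure.dirac x) t)) (toForm α) ≤
      ENNReal.ofReal (r t)) :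
    ∃ η : E → ℝ, IsBddMeas η ∧ (∀ x, 0 ≤ η x) ∧ ∫ x, η x ∂α = 1 ∧
      ∀ x t, |S.scaledSurvival lam t x - η x| ≤ K * (K * r t) := by
  have hrate : Tendsto (fun t => K * (K * r t)) atTop (𝓝 0) := by
    simpa using (hr0.const_mul K).const_mul K
  choose η hη using fun x => exists_abs_sub_le_of_abs_add_sub_le
    (h := fun t => S.scaledSurvival lam t x) hrate
    fun t u => D.abs_scaledSurvival_add_sub_le hα hr htv t u x
  have hlim (x : E) : Tendsto (fun t => S.scaledSurvival lam t x) atTop (𝓝 (η x)) :=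
    tendsto_iff_norm_sub_tendsto_zero.2
      (squeeze_zero (fun _ => norm_nonneg _) (hη x) hrate)
  have hη0 (x : E) : 0 ≤ η x := ge_of_tendsto' (hlim x) fun t => S.scaledSurvival_nonneg lam t x
  have hηK (x : E) : η x ≤ K := le_of_tendsto' (hlim x) fun t => D.scaledSurvival_le t x
  have hηm : Measurable η := measurable_of_tendsto_metrizable' atTop
    (fun t => (S.isBddMeas_scaledSurvival lam t).1) (tendsto_pi_nhds.2 hlim)
  refine ⟨η, ⟨hηm, K, fun x => (abs_of_nonneg (hη0 x)).trans_le (hηK x)⟩, hη0, ?_, hη⟩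
  have hint : Tendsto (fun t => ∫ x, S.scaledSurvival lam t x ∂α) atTop (𝓝 (∫ x, η x ∂α)) :=
    tendsto_integral_filter_of_dominated_convergence (fun _ => K)
      (Eventually.of_forall fun t => (S.isBddMeas_scaledSurvival lam t).1.aestronglyMeasurable)
      (Eventually.of_forall fun t => Eventually.of_forall fun x => by
        rw [Real.norm_of_nonneg (S.scaledSurvival_nonneg lam t x)]
        exact D.scaledSurvival_le t x)
      (integrable_const _) (Eventually.of_forall hlim)
  simp only [integral_scaledSurvival hα] at hint
  exact tendsto_nhds_unique hint tendsto_const_nhds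

end RescaledLimit

end SubMarkovSemigroup

section ExponentialSeries

variable {a : ℕ → ℝ} {R q : ℝ}

lemma hasSum_pow_div_factorial_mul (t c q : ℝ) :
    HasSum (fun n : ℕ => t ^ n / (n.factorial : ℝ) * (c * q ^ n)) (c * Real.exp (t * q)) := by
  rw [Real.exp_eq_exp_ℝ]
  refine ((NormedSpace.expSeries_div_hasSum_exp (t * q)).mul_left c).congr_fun fun n => ?_
  rw [mul_pow]
  ring

lemma summable_pow_div_factorial_mul (ha : ∀ n, |a n| ≤ R * q ^ n) (t : ℝ) :
    Summable fun n : ℕ => t ^ n / (n.factorial : ℝ) * a n := by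
  refine .of_norm_bounded (hasSum_pow_div_factorial_mul |t| R q).summable fun n => ?_
  rw [norm_mul, norm_div, norm_pow, Real.norm_natCast]
  exact mul_le_mul_of_nonneg_left (ha n) (by positivity)

lemma abs_tsum_pow_div_factorial_mul_le (ha : ∀ n, |a n| ≤ R * q ^ n) {t : ℝ} (ht : 0 ≤ t) :
    |∑' n : ℕ, t ^ n / (n.factorial : ℝ) * a n| ≤ R * Real.exp (t * q) := by
  refine tsum_of_norm_bounded (f := fun n : ℕ => t ^ n / (n.factorial : ℝ) * a n)
    (hasSum_pow_div_factorial_mul t R q) fun n => ?_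
  rw [norm_mul, Real.norm_of_nonneg (by positivity)]
  exact mul_le_mul_of_nonneg_left (ha n) (by positivity)

lemma abs_tsum_pow_div_factorial_mul_sub_le {c p : ℝ} (ha : ∀ n, |a n - c * p ^ n| ≤ R * q ^ n)
    {t : ℝ} (ht : 0 ≤ t) :
    |∑' n : ℕ, t ^ n / (n.factorial : ℝ) * a n - c * Real.exp (t * p)| ≤
      R * Real.exp (t * q) := by
  have hsum := (summable_pow_div_factorial_mul ha t).hasSum.add
    (hasSum_pow_div_factorial_mul t c p)
  simp only [← mul_add, sub_add_cancel] at hsum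
  rw [hsum.tsum_eq, add_sub_cancel_right]
  exact abs_tsum_pow_div_factorial_mul_le ha ht

end ExponentialSeries

lemma integral_mul_exp_neg_mul_Ioi (c : ℝ) {b : ℝ} (hb : 0 < b) :
    ∫ s in Set.Ioi (0 : ℝ), c * Real.exp (-b * s) = c / b := by
  rw [integral_const_mul, integral_exp_mul_Ioi (neg_lt_zero.2 hb), mul_zero, Real.exp_zero,
    neg_div_neg_eq, mul_one_div]

namespace SubMarkovSemigroup

section Green

variable {E : Type*} [MeasurableSpace E] (S : SubMarkovSemigroup E)

/-- The Green operator `f ↦ ∫_0^∞ P_s f ds`. -/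
def green (f : E → ℝ) (x : E) : ℝ := ∫ s in Set.Ioi (0 : ℝ), S.op s.toNNReal f x

/-- The exponential `e^{tA}` of the Green operator `A`. -/
def expGreen (t : ℝ) (f : E → ℝ) (x : E) : ℝ :=
  ∑' n : ℕ, t ^ n / (n.factorial : ℝ) * (S.green^[n] f) x

lemma measurable_op_toNNReal {f : E → ℝ} (hf : Measurable f) :
    Measurable fun p : E × ℝ => S.op p.2.toNNReal f p.1 :=
  (S.measurable_op_uncurry hf).comp
    ((measurable_real_toNNReal.comp measurable_snd).prodMk measurable_fst)

lemma measurable_green {f : E → ℝ} (hf : Measurable f) : Measurable (S.green f) :=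
  (S.measurable_op_toNNReal hf).stronglyMeasurable.integral_prod_right.measurable

lemma measurable_green_iterate {f : E → ℝ} (hf : Measurable f) (n : ℕ) :
    Measurable (S.green^[n] f) :=
  Function.Iterate.rec _ hf (fun _ hg => S.measurable_green hg) n

variable {S}

lemma op_pos (hpos : ∀ t x, 0 < S.survival t x) {f : E → ℝ} (hf : IsBddMeas f)
    (hf0 : ∀ x, 0 < f x) (t : ℝ≥0) (x : E) : 0 < S.op t f x := by
  have := isProbabilityMeasure_condLaw hpos (Measure.dirac x) t
  rw [S.op_eq_survival_mul t hf]
  exact mul_pos (hpos t x) (hf.integral_pos hf0 _)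

namespace ExpDecay

variable {K lam : ℝ} {f g : E → ℝ}

lemma bound_nonneg (D : S.ExpDecay K lam) (x : E) : 0 ≤ K := by
  simpa using (S.survival_nonneg 0 x).trans (D.survival_le 0 x)

lemma abs_op_le (D : S.ExpDecay K lam) (hf : IsBddMeas f) (t : ℝ≥0) (x : E) :
    |S.op t f x| ≤ supNorm f * K * Real.exp (-lam * t) :=
  ((S.abs_op_le hf.abs_le_supNorm t x).trans
    (mul_le_mul_of_nonneg_left (D.survival_le t x) (supNorm_nonneg f))).trans_eq
    (mul_assoc _ _ _).symm

lemma abs_op_toNNReal_le (D : S.ExpDecay K lam) (hf : IsBddMeas f) {s : ℝ} (hs : 0 < s) (x : E) :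
    |S.op s.toNNReal f x| ≤ supNorm f * K * Real.exp (-lam * s) := by
  simpa only [Real.coe_toNNReal s hs.le] using D.abs_op_le hf s.toNNReal x

lemma integrableOn_op (D : S.ExpDecay K lam) (hf : IsBddMeas f) (x : E) :
    IntegrableOn (fun s : ℝ => S.op s.toNNReal f x) (Set.Ioi 0) := by
  refine ((integrableOn_exp_mul_Ioi (neg_lt_zero.2 D.rate_pos) 0).const_mul
    (supNorm f * K)).mono'
    ((S.measurable_op_toNNReal hf.1).comp measurable_prodMk_left).aestronglyMeasurable ?_
  filter_upwards [ae_restrict_mem measurableSet_Ioi] with s hs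
  exact D.abs_op_toNNReal_le hf hs x

lemma abs_green_sub_le (D : S.ExpDecay K lam) (hf : IsBddMeas f) {x : E} {c R ρ : ℝ}
    (hρ : 0 < ρ)
    (h : ∀ t : ℝ≥0, |S.op t f x - c * Real.exp (-lam * t)| ≤ R * Real.exp (-ρ * t)) :
    |S.green f x - c / lam| ≤ R / ρ := by
  have hexp {b : ℝ} (hb : 0 < b) (c : ℝ) :
      IntegrableOn (fun s : ℝ => c * Real.exp (-b * s)) (Set.Ioi 0) :=
    (integrableOn_exp_mul_Ioi (neg_lt_zero.2 hb) 0).const_mul c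
  rw [green, ← integral_mul_exp_neg_mul_Ioi c D.rate_pos, ← integral_mul_exp_neg_mul_Ioi R hρ,
    ← integral_sub (D.integrableOn_op hf x) (hexp D.rate_pos c)]
  refine norm_integral_le_of_norm_le (f := fun s : ℝ => S.op s.toNNReal f x - c * _) (hexp hρ R) ?_
  filter_upwards [ae_restrict_mem measurableSet_Ioi] with s hs
  simpa only [Real.coe_toNNReal s (Set.mem_Ioi.1 hs).le, Real.norm_eq_abs] using h s.toNNReal

lemma abs_green_le (D : S.ExpDecay K lam) (hf : IsBddMeas f) (x : E) :
    |S.green f x| ≤ K / lam * supNorm f := by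
  have h := D.abs_green_sub_le hf (x := x) (c := 0) D.rate_pos fun t => by
    simpa using D.abs_op_le hf t x
  rw [zero_div, sub_zero] at h
  exact h.trans_eq (by ring)

lemma isBddMeas_green (D : S.ExpDecay K lam) (hf : IsBddMeas f) : IsBddMeas (S.green f) :=
  ⟨S.measurable_green hf.1, _, D.abs_green_le hf⟩

lemma isBddMeas_green_iterate (D : S.ExpDecay K lam) (hf : IsBddMeas f) (n : ℕ) :
    IsBddMeas (S.green^[n] f) :=
  Function.Iterate.rec _ hf (fun _ hg => D.isBddMeas_green hg) n

lemma supNorm_green_le (D : S.ExpDecay K lam) (hf : IsBddMeas f) :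
    supNorm (S.green f) ≤ K / lam * supNorm f := supNorm_le_mul_supNorm (D.abs_green_le hf)

lemma abs_green_iterate_le (D : S.ExpDecay K lam) (hf : IsBddMeas f) (n : ℕ) (x : E) :
    |(S.green^[n] f) x| ≤ supNorm f * (K / lam) ^ n := by
  have hK : 0 ≤ K / lam := div_nonneg (D.bound_nonneg x) D.rate_pos.le
  refine ((D.isBddMeas_green_iterate hf n).abs_le_supNorm x).trans ?_
  induction n with
  | zero => simp
  | succ n ih =>
    rw [Function.iterate_succ_apply']
    calc supNorm (S.green (S.green^[n] f)) ≤ K / lam * supNorm (S.green^[n] f) :=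
          D.supNorm_green_le (D.isBddMeas_green_iterate hf n)
      _ ≤ K / lam * (supNorm f * (K / lam) ^ n) := mul_le_mul_of_nonneg_left ih hK
      _ = supNorm f * (K / lam) ^ (n + 1) := by ring

lemma abs_green_le_green (D : S.ExpDecay K lam) (hg : IsBddMeas g) (h : ∀ x, |f x| ≤ g x)
    (x : E) : |S.green f x| ≤ S.green g x :=
  norm_integral_le_of_norm_le (f := fun s : ℝ => S.op s.toNNReal f x) (D.integrableOn_op hg x)
    (Eventually.of_forall fun _ =>
      norm_integral_le_of_norm_le (f := f) (hg.integrable _) (Eventually.of_forall h))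

lemma abs_green_iterate_le_green_iterate (D : S.ExpDecay K lam) (hg : IsBddMeas g)
    (h : ∀ x, |f x| ≤ g x) (n : ℕ) (x : E) : |(S.green^[n] f) x| ≤ (S.green^[n] g) x := by
  induction n generalizing x with
  | zero => exact h x
  | succ n ih =>
    rw [Function.iterate_succ_apply', Function.iterate_succ_apply']
    exact D.abs_green_le_green (D.isBddMeas_green_iterate hg n) ih x

lemma green_pos (D : S.ExpDecay K lam) (hpos : ∀ t x, 0 < S.survival t x) (hf : IsBddMeas f)
    (hf0 : ∀ x, 0 < f x) (x : E) : 0 < S.green f x := by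
  have hop (s : ℝ) : 0 < S.op s.toNNReal f x := op_pos hpos hf hf0 _ x
  rw [green, integral_pos_iff_support_of_nonneg (fun s => (hop s).le) (D.integrableOn_op hf x),
    Function.support_eq_univ fun s => (hop s).ne']
  simp

lemma green_iterate_pos (D : S.ExpDecay K lam) (hpos : ∀ t x, 0 < S.survival t x)
    (hf : IsBddMeas f) (hf0 : ∀ x, 0 < f x) (n : ℕ) (x : E) : 0 < (S.green^[n] f) x := by
  induction n generalizing x with
  | zero => exact hf0 x
  | succ n ih =>
    rw [Function.iterate_succ_apply']
    exact D.green_pos hpos (D.isBddMeas_green_iterate hf n) ih x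

lemma op_green (D : S.ExpDecay K lam) (hf : IsBddMeas f) (t : ℝ≥0) (x : E) :
    S.op t (S.green f) x = S.green (S.op t f) x := by
  have hint : Integrable (Function.uncurry fun (y : E) (s : ℝ) => S.op s.toNNReal f y)
      ((S.P (t, x)).prod (volume.restrict (Set.Ioi 0))) := by
    refine (((integrableOn_exp_mul_Ioi (neg_lt_zero.2 D.rate_pos) 0).const_mul
      (supNorm f * K)).comp_snd _).mono' (S.measurable_op_toNNReal hf.1).aestronglyMeasurable ?_
    filter_upwards [Measure.quasiMeasurePreserving_snd.ae (ae_restrict_mem measurableSet_Ioi)]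
      with p hp
    exact D.abs_op_toNNReal_le hf hp p.1
  calc S.op t (S.green f) x = ∫ s in Set.Ioi (0 : ℝ), S.op t (S.op s.toNNReal f) x :=
        integral_integral_swap hint
    _ = S.green (S.op t f) x := by simp only [green, ← S.op_add hf, add_comm]

/-- The Green operator commutes with `P_t`, so that `P_t A f = A (P_t f)` is estimated by
integrating the hypothesis over `[t, ∞)`. -/
lemma abs_op_green_sub_le (D : S.ExpDecay K lam) (hf : IsBddMeas f) {x : E} {c R ρ : ℝ}
    (hρ : 0 < ρ)
    (h : ∀ t : ℝ≥0, |S.op t f x - c * Real.exp (-lam * t)| ≤ R * Real.exp (-ρ * t)) (t : ℝ≥0) :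
    |S.op t (S.green f) x - c / lam * Real.exp (-lam * t)| ≤ R / ρ * Real.exp (-ρ * t) := by
  rw [D.op_green hf, div_mul_eq_mul_div, div_mul_eq_mul_div]
  refine D.abs_green_sub_le (S.isBddMeas_op hf t) hρ fun s => ?_
  rw [← S.op_add hf, mul_assoc, mul_assoc, ← Real.exp_add, ← Real.exp_add, ← mul_add, ← mul_add]
  simpa only [add_comm s, NNReal.coe_add] using h (t + s)

lemma abs_green_iterate_sub_le (D : S.ExpDecay K lam) (hf : IsBddMeas f) {x : E} {c R ρ : ℝ}
    (hρ : 0 < ρ)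
    (h : ∀ t : ℝ≥0, |S.op t f x - c * Real.exp (-lam * t)| ≤ R * Real.exp (-ρ * t)) (n : ℕ) :
    |(S.green^[n] f) x - c / lam ^ n| ≤ R / ρ ^ n := by
  suffices hop : ∀ t : ℝ≥0, |S.op t (S.green^[n] f) x - c / lam ^ n * Real.exp (-lam * t)| ≤
      R / ρ ^ n * Real.exp (-ρ * t) by
    simpa [S.op_zero (S.measurable_green_iterate hf.1 n)] using hop 0
  induction n with
  | zero => simpa using h
  | succ n ih =>
    simp only [Function.iterate_succ_apply', pow_succ, ← div_div]
    exact D.abs_op_green_sub_le (D.isBddMeas_green_iterate hf n) hρ ih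

lemma summable_expGreen (D : S.ExpDecay K lam) (hf : IsBddMeas f) (t : ℝ) (x : E) :
    Summable fun n : ℕ => t ^ n / (n.factorial : ℝ) * (S.green^[n] f) x :=
  summable_pow_div_factorial_mul (fun n => D.abs_green_iterate_le hf n x) t

lemma isBddMeas_expGreen (D : S.ExpDecay K lam) (hf : IsBddMeas f) {t : ℝ} (ht : 0 ≤ t) :
    IsBddMeas (S.expGreen t f) := by
  refine ⟨?_, _, fun x => abs_tsum_pow_div_factorial_mul_le
    (fun n => D.abs_green_iterate_le hf n x) ht⟩
  exact measurable_of_tendsto_metrizable (fun N => Finset.measurable_sum (Finset.range N)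
    fun n _ => (S.measurable_green_iterate hf.1 n).const_mul (t ^ n / (n.factorial : ℝ)))
    (tendsto_pi_nhds.2 fun x => by
      simpa [expGreen] using (D.summable_expGreen hf t x).hasSum.tendsto_sum_nat)

lemma abs_expGreen_le_expGreen (D : S.ExpDecay K lam) (hg : IsBddMeas g) (h : ∀ x, |f x| ≤ g x)
    {t : ℝ} (ht : 0 ≤ t) (x : E) : |S.expGreen t f x| ≤ S.expGreen t g x := by
  rw [expGreen, ← Real.norm_eq_abs]
  refine tsum_of_norm_bounded (D.summable_expGreen hg t x).hasSum fun n => ?_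
  rw [norm_mul, Real.norm_of_nonneg (by positivity)]
  exact mul_le_mul_of_nonneg_left (D.abs_green_iterate_le_green_iterate hg h n x) (by positivity)

lemma expGreen_pos (D : S.ExpDecay K lam) (hpos : ∀ t x, 0 < S.survival t x) (hf : IsBddMeas f)
    (hf0 : ∀ x, 0 < f x) {t : ℝ} (ht : 0 ≤ t) (x : E) : 0 < S.expGreen t f x := by
  refine (D.summable_expGreen hf t x).tsum_pos (fun n => ?_) 0 (by simpa using hf0 x)
  exact mul_nonneg (by positivity) (D.green_iterate_pos hpos hf hf0 n x).le

lemma abs_expGreen_sub_le (D : S.ExpDecay K lam) (hf : IsBddMeas f) {x : E} {c R ρ : ℝ}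
    (hρ : 0 < ρ)
    (h : ∀ t : ℝ≥0, |S.op t f x - c * Real.exp (-lam * t)| ≤ R * Real.exp (-ρ * t))
    {t : ℝ} (ht : 0 ≤ t) :
    |S.expGreen t f x - c * Real.exp (t / lam)| ≤ R * Real.exp (t / ρ) := by
  rw [div_eq_mul_inv t lam, div_eq_mul_inv t ρ]
  refine abs_tsum_pow_div_factorial_mul_sub_le (fun n => ?_) ht
  simpa only [inv_pow, ← div_eq_mul_inv] using D.abs_green_iterate_sub_le hf hρ h n

end ExpDecay

end Green

section SpectralEstimate

variable {E : Type*} [MeasurableSpace E] {S : SubMarkovSemigroup E} {α ν : Measure E}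
  {K lam c₁ c₂ : ℝ} {t₀ : ℝ≥0} {x : E}

lemma survival_eq_exp_mul_scaledSurvival (lam : ℝ) (t : ℝ≥0) (x : E) :
    S.survival t x = Real.exp (-lam * t) * S.scaledSurvival lam t x := by
  rw [scaledSurvival, ← mul_assoc, ← Real.exp_add, neg_mul, neg_add_cancel, Real.exp_zero, one_mul]

lemma ExpDecay.abs_op_sub_le [IsProbabilityMeasure α] (D : S.ExpDecay K lam) {f : E → ℝ}
    (hf : IsBddMeas f) {t : ℝ≥0} {h r r' : ℝ} (hr : 0 ≤ r)
    (htv : tvDist (toForm (S.condLaw (Measure.dirac x) t)) (toForm α) ≤ ENNReal.ofReal r)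
    (hh : |S.scaledSurvival lam t x - h| ≤ r') :
    |S.op t f x - (∫ y, f y ∂α) * h * Real.exp (-lam * t)| ≤
      (r * K + r') * supNorm f * Real.exp (-lam * t) := by
  let s := S.scaledSurvival lam t x
  let v := ∫ y, f y ∂(S.condLaw (Measure.dirac x) t)
  let w := ∫ y, f y ∂α
  have hs : |s| ≤ K := by
    rw [abs_of_nonneg (S.scaledSurvival_nonneg lam t x)]
    exact D.scaledSurvival_le t x
  have hsplit : S.op t f x - w * h * Real.exp (-lam * t) =
      (s * (v - w) + w * (s - h)) * Real.exp (-lam * t) := by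
    rw [S.op_eq_survival_mul t hf, survival_eq_exp_mul_scaledSurvival lam]
    ring
  rw [hsplit, abs_mul, Real.abs_exp]
  refine mul_le_mul_of_nonneg_right ?_ (Real.exp_pos _).le
  calc |s * (v - w) + w * (s - h)| ≤ |s| * |v - w| + |w| * |s - h| := by
        simpa only [abs_mul] using abs_add_le (s * (v - w)) (w * (s - h))
    _ ≤ K * (supNorm f * r) + supNorm f * r' :=
        add_le_add
          (mul_le_mul hs (abs_integral_sub_le_of_tvDist_le hr htv hf) (abs_nonneg _)
            (D.bound_nonneg x))
          (mul_le_mul (hf.abs_integral_le_supNorm α) hh (abs_nonneg _) (supNorm_nonneg f))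
    _ = (r * K + r') * supNorm f := by ring

lemma Doeblin.mul_scaledSurvival_le [IsProbabilityMeasure α] (H : S.Doeblin ν t₀ c₁ c₂)
    (hα : ∀ t : ℝ≥0, ∫ x, S.survival t x ∂α = Real.exp (-lam * t)) (u : ℝ≥0) (x : E) :
    c₁ * c₂ * S.scaledSurvival lam t₀ x ≤ S.scaledSurvival lam (t₀ + u) x := by
  have hν : c₂ * Real.exp (-lam * u) ≤ ∫ y, S.survival u y ∂ν := by
    have hmono := integral_mono (((S.isBddMeas_survival u).const_mul c₂).integrable α)
      (integrable_const _) (H.survival_le u)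
    rwa [integral_const_mul, hα, integral_const, probReal_univ, one_smul] at hmono
  have hstep : S.survival t₀ x * (c₁ * (c₂ * Real.exp (-lam * u))) ≤ S.survival (t₀ + u) x := by
    rw [survival_add]
    exact (mul_le_mul_of_nonneg_left (mul_le_mul_of_nonneg_left hν H.c₁_pos.le)
      (S.survival_nonneg t₀ x)).trans
      (H.mul_integral_le_op (S.isBddMeas_survival u) (S.survival_nonneg u) x)
  rw [survival_eq_exp_mul_scaledSurvival lam, survival_eq_exp_mul_scaledSurvival lam (t₀ + u),
    NNReal.coe_add, mul_add, Real.exp_add] at hstep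
  refine le_of_mul_le_mul_left (le_trans (le_of_eq ?_) hstep)
    (mul_pos (Real.exp_pos (-lam * t₀)) (Real.exp_pos (-lam * u)))
  ring

lemma Doeblin.limit_scaledSurvival_pos [IsProbabilityMeasure α] (H : S.Doeblin ν t₀ c₁ c₂)
    (hα : ∀ t : ℝ≥0, ∫ x, S.survival t x ∂α = Real.exp (-lam * t)) {h : ℝ}
    (hlim : Tendsto (fun t => S.scaledSurvival lam t x) atTop (𝓝 h)) : 0 < h := by
  have hpos : 0 < c₁ * c₂ * S.scaledSurvival lam t₀ x :=
    mul_pos (mul_pos H.c₁_pos H.c₂_pos) (mul_pos (Real.exp_pos _) (H.survival_pos t₀ x))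
  refine hpos.trans_le (ge_of_tendsto hlim ?_)
  filter_upwards [eventually_ge_atTop t₀] with t ht
  obtain ⟨u, rfl⟩ := exists_add_of_le ht
  exact H.mul_scaledSurvival_le hα u x

end SpectralEstimate

end SubMarkovSemigroup

section Cemetery

variable {E : Type*} [MeasurableSpace E]

lemma measurableEmbedding_inl : MeasurableEmbedding (Sum.inl : E → WithCemetery E) :=
  ⟨Sum.inl_injective, measurable_inl, fun _ hs => hs.inl_image⟩

lemma lintegral_comap_inl (m : Measure (WithCemetery E)) {g : WithCemetery E → ℝ≥0∞}
    (hg : g cemetery = 0) : ∫⁻ y, g (Sum.inl y) ∂(m.comap Sum.inl) = ∫⁻ z, g z ∂m := by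
  rw [← measurableEmbedding_inl.lintegral_map, measurableEmbedding_inl.map_comap,
    setLIntegral_eq_of_support_subset]
  rintro (x | ⟨⟩) hx
  · exact ⟨x, rfl⟩
  · exact absurd hg hx

lemma integral_comap_inl (m : Measure (WithCemetery E)) {g : WithCemetery E → ℝ}
    (hg : g cemetery = 0) : ∫ y, g (Sum.inl y) ∂(m.comap Sum.inl) = ∫ z, g z ∂m := by
  rw [← measurableEmbedding_inl.integral_map, measurableEmbedding_inl.map_comap,
    setIntegral_eq_integral_of_forall_compl_eq_zero]
  rintro (x | ⟨⟩) hx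
  · exact absurd ⟨x, rfl⟩ hx
  · exact hg

end Cemetery

namespace AbsorbedMarkovProcess

section Semigroup

variable {E Ω : Type*} [MeasurableSpace E] [MeasurableSpace Ω] (𝕏 : AbsorbedMarkovProcess E Ω)

instance : IsMarkovKernel 𝕏.law := 𝕏.isMarkovKernel

instance (x : E) : IsProbabilityMeasure (𝕏.pr x) := by unfold pr; infer_instance

lemma measurable_X (t : ℝ≥0) : Measurable (𝕏.X t) := 𝕏.measurable.comp measurable_prodMk_left

lemma τ_le {t : ℝ≥0} {ω : Ω} (h : 𝕏.X t ω = cemetery) : 𝕏.τ ω ≤ t := iInf₂_le t h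

lemma X_mem_range_inl {t : ℝ≥0} {ω : Ω} (h : t < 𝕏.τ ω) : 𝕏.X t ω ∈ Set.range Sum.inl := by
  rcases hX : 𝕏.X t ω with x | ⟨⟩
  · exact Set.mem_range_self x
  · exact absurd (𝕏.τ_le hX) h.not_ge

lemma prInit_dirac (x : E) : 𝕏.prInit (Measure.dirac x) = 𝕏.pr x := by
  rw [prInit, Measure.map_dirac' measurable_inl, Measure.dirac_bind 𝕏.law.measurable, pr]

lemma lt_τ_ae_eq (μ : Measure E) [IsProbabilityMeasure μ] (t : ℝ≥0) :
    {ω | t < 𝕏.τ ω} =ᵐ[𝕏.prInit μ] 𝕏.X t ⁻¹' Set.range Sum.inl := by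
  filter_upwards [𝕏.absorbed (μ.map Sum.inl)
    (Measure.isProbabilityMeasure_map measurable_inl.aemeasurable)] with ω hω
  refine propext ⟨𝕏.X_mem_range_inl, fun ⟨x, hx⟩ => not_le.1 fun hle => ?_⟩
  exact Sum.inl_ne_inr (hx.trans (hω t hle))

lemma lt_τ_ae_eq_pr (x : E) (t : ℝ≥0) :
    {ω | t < 𝕏.τ ω} =ᵐ[𝕏.pr x] 𝕏.X t ⁻¹' Set.range Sum.inl := by
  simpa only [prInit_dirac] using 𝕏.lt_τ_ae_eq (Measure.dirac x) t

lemma law_cemetery_preimage_inl_image (t : ℝ≥0) (B : Set E) :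
    𝕏.law cemetery (𝕏.X t ⁻¹' (Sum.inl '' B)) = 0 := by
  have hstart : 𝕏.law cemetery (𝕏.X 0 ⁻¹' Set.range Sum.inl) = 0 := by
    rw [← Measure.map_apply (𝕏.measurable_X 0) measurableSet_range_inl, 𝕏.start,
      Measure.dirac_apply' _ measurableSet_range_inl]
    simp
  have habs := 𝕏.absorbed (Measure.dirac cemetery) inferInstance
  rw [Measure.dirac_bind 𝕏.law.measurable] at habs
  refine measure_eq_zero_iff_ae_notMem.2 ?_
  filter_upwards [measure_eq_zero_iff_ae_notMem.1 hstart, habs] with ω h0 hω hmem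
  have hτ : 𝕏.τ ω ≤ t := by
    by_contra! hlt
    exact h0 (𝕏.X_mem_range_inl (hlt.trans_le' (by simp)))
  obtain ⟨y, -, hy⟩ := hmem
  exact Sum.inl_ne_inr (hy.trans (hω t hτ))

/-- The law of `X_t` under `ℙ_x`, as a kernel in `(t, x)`. -/
def position : Kernel (ℝ≥0 × E) (WithCemetery E) :=
  ((Kernel.deterministic Prod.fst measurable_fst) ×ₖ
    (𝕏.law.comap (fun p : ℝ≥0 × E => Sum.inl p.2) (measurable_inl.comp measurable_snd))).map
    (fun p : ℝ≥0 × Ω => 𝕏.X p.1 p.2)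

lemma position_apply (t : ℝ≥0) (x : E) : 𝕏.position (t, x) = (𝕏.pr x).map (𝕏.X t) := by
  rw [position, Kernel.map_apply _ 𝕏.measurable, Kernel.prod_apply, Kernel.deterministic_apply,
    Kernel.comap_apply, Measure.dirac_prod, Measure.map_map 𝕏.measurable measurable_prodMk_left]
  rfl

/-- The transition kernels `P_t(x, B) = ℙ_x(X_t ∈ B)` for `B ⊆ E`. -/
def transition : Kernel (ℝ≥0 × E) E := 𝕏.position.comapRight measurableEmbedding_inl

lemma transition_apply (t : ℝ≥0) (x : E) :
    𝕏.transition (t, x) = ((𝕏.pr x).map (𝕏.X t)).comap Sum.inl := by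
  rw [transition, Kernel.comapRight_apply, position_apply]

lemma transition_apply' (t : ℝ≥0) (x : E) {B : Set E} (hB : MeasurableSet B) :
    𝕏.transition (t, x) B = 𝕏.pr x (𝕏.X t ⁻¹' (Sum.inl '' B)) := by
  rw [transition_apply, measurableEmbedding_inl.comap_apply,
    Measure.map_apply (𝕏.measurable_X t) hB.inl_image]

lemma transition_zero (x : E) : 𝕏.transition (0, x) = Measure.dirac x := by
  refine Measure.ext fun B hB => ?_
  rw [transition_apply, pr, 𝕏.start, measurableEmbedding_inl.comap_apply,
    Measure.dirac_apply' _ hB, Measure.dirac_apply' _ hB.inl_image]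
  by_cases hx : x ∈ B <;> simp [hx]

lemma transition_add (s t : ℝ≥0) (x : E) :
    𝕏.transition (s + t, x) = (𝕏.transition (s, x)).bind fun y => 𝕏.transition (t, y) := by
  refine Measure.ext fun B hB => ?_
  have hmeas : Measurable fun z => 𝕏.law z (𝕏.X t ⁻¹' (Sum.inl '' B)) :=
    𝕏.law.measurable_coe (𝕏.measurable_X t hB.inl_image)
  have hmarkov := 𝕏.markov (Sum.inl x) s t Set.univ (Sum.inl '' B) .univ hB.inl_image
  rw [Set.univ_inter, Measure.restrict_univ] at hmarkov
  have htransition : Measurable fun y => 𝕏.transition (t, y) :=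
    𝕏.transition.measurable.comp measurable_prodMk_left
  rw [Measure.bind_apply hB htransition.aemeasurable, transition_apply' _ _ _ hB, pr, hmarkov,
    ← lintegral_map hmeas (𝕏.measurable_X s),
    ← lintegral_comap_inl _ (𝕏.law_cemetery_preimage_inl_image t B), transition_apply]
  exact lintegral_congr fun y => (𝕏.transition_apply' t y hB).symm

/-- The semigroup `P_t` of the process before absorption. -/
def toSemigroup : SubMarkovSemigroup E where
  P := 𝕏.transition
  mass_le := fun (t, x) => (𝕏.transition_apply' t x .univ).trans_le prob_le_one
  zero := 𝕏.transition_zero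
  add := 𝕏.transition_add

lemma prInit_preimage_inl_image (μ : Measure E) (t : ℝ≥0) {B : Set E} (hB : MeasurableSet B) :
    𝕏.prInit μ (𝕏.X t ⁻¹' (Sum.inl '' B)) = 𝕏.toSemigroup.push μ t B := by
  have hX : MeasurableSet (𝕏.X t ⁻¹' (Sum.inl '' B)) := 𝕏.measurable_X t hB.inl_image
  rw [prInit, Measure.bind_apply hX 𝕏.law.measurable.aemeasurable,
    lintegral_map (𝕏.law.measurable_coe hX) measurable_inl, SubMarkovSemigroup.push,
    Measure.bind_apply hB (Kernel.measurable _).aemeasurable]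
  exact lintegral_congr fun y => (𝕏.transition_apply' t y hB).symm

lemma prInit_lt_τ (μ : Measure E) [IsProbabilityMeasure μ] (t : ℝ≥0) :
    𝕏.prInit μ {ω | t < 𝕏.τ ω} = 𝕏.toSemigroup.push μ t Set.univ := by
  rw [measure_congr (𝕏.lt_τ_ae_eq μ t), ← Set.image_univ, 𝕏.prInit_preimage_inl_image μ t .univ]

lemma condLaw_prInit (μ : Measure E) [IsProbabilityMeasure μ] (t : ℝ≥0) :
    𝕏.condLaw (𝕏.prInit μ) t = 𝕏.toSemigroup.condLaw μ t := by
  refine Measure.ext fun B hB => ?_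
  have hX : MeasurableSet (𝕏.X t ⁻¹' (Sum.inl '' B)) := 𝕏.measurable_X t hB.inl_image
  rw [condLaw, measurableEmbedding_inl.comap_apply, Measure.map_apply (𝕏.measurable_X t)
    hB.inl_image, ProbabilityTheory.cond, Measure.restrict_congr_set (𝕏.lt_τ_ae_eq μ t),
    Measure.smul_apply, Measure.restrict_apply hX, prInit_lt_τ,
    Set.inter_eq_left.2 (Set.preimage_mono (Set.image_subset_range _ _)),
    𝕏.prInit_preimage_inl_image μ t hB]
  rfl

lemma condLaw_pr (x : E) (t : ℝ≥0) :
    𝕏.condLaw (𝕏.pr x) t = 𝕏.toSemigroup.condLaw (Measure.dirac x) t := by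
  rw [← prInit_dirac, condLaw_prInit]

lemma survival_prInit (μ : Measure E) [IsProbabilityMeasure μ] (t : ℝ≥0) :
    𝕏.survival (𝕏.prInit μ) t = ∫ x, 𝕏.toSemigroup.survival t x ∂μ := by
  rw [survival, measureReal_def, prInit_lt_τ, ← measureReal_def, SubMarkovSemigroup.push_real_univ]

lemma survival_pr (x : E) (t : ℝ≥0) :
    𝕏.survival (𝕏.pr x) t = 𝕏.toSemigroup.survival t x := by
  rw [← prInit_dirac, survival_prInit,
    integral_dirac' _ _ (𝕏.toSemigroup.isBddMeas_survival t).1.stronglyMeasurable]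

lemma semigroup_eq {f : E → ℝ} (hf : Measurable f) (t : ℝ≥0) :
    𝕏.semigroup t f = 𝕏.toSemigroup.op t f := by
  ext x
  let g : WithCemetery E → ℝ := Sum.elim f fun _ => 0
  have hg : Measurable g := measurable_fun_sum hf measurable_const
  calc 𝕏.semigroup t f x = ∫ ω, g (𝕏.X t ω) ∂(𝕏.pr x) := by
        refine integral_congr_ae ((indicator_ae_eq_of_ae_eq_set (𝕏.lt_τ_ae_eq_pr x t)).trans
          (Eventually.of_forall fun ω => ?_))
        rcases hX : 𝕏.X t ω with y | ⟨⟩ <;> simp [g, Set.indicator, hX]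
    _ = ∫ z, g z ∂((𝕏.pr x).map (𝕏.X t)) :=
        (integral_map (𝕏.measurable_X t).aemeasurable hg.aestronglyMeasurable).symm
    _ = ∫ y, f y ∂(𝕏.transition (t, x)) := by
        rw [transition_apply]
        exact (integral_comap_inl _ rfl).symm

lemma green_eq {f : E → ℝ} (hf : Measurable f) : 𝕏.green f = 𝕏.toSemigroup.green f := by
  ext x
  simp only [green, SubMarkovSemigroup.green, 𝕏.semigroup_eq hf]

lemma green_iterate_eq {f : E → ℝ} (hf : Measurable f) (n : ℕ) :
    𝕏.green^[n] f = 𝕏.toSemigroup.green^[n] f := by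
  induction n with
  | zero => rfl
  | succ n ih =>
    rw [Function.iterate_succ_apply', Function.iterate_succ_apply', ih,
      𝕏.green_eq (𝕏.toSemigroup.measurable_green_iterate hf n)]

lemma expGreen_eq {f : E → ℝ} (hf : Measurable f) (t : ℝ) :
    𝕏.expGreen t f = 𝕏.toSemigroup.expGreen t f := by
  ext x
  simp only [expGreen, SubMarkovSemigroup.expGreen, 𝕏.green_iterate_eq hf]

variable {𝕏}

lemma tendsto_survival_zero {x : E} (hfin : ∀ᵐ ω ∂(𝕏.pr x), 𝕏.τ ω < ∞) :
    Tendsto (fun t => 𝕏.toSemigroup.survival t x) atTop (𝓝 0) := by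
  have hnull : 𝕏.pr x (⋂ t : ℝ≥0, {ω | t < 𝕏.τ ω}) = 0 := by
    refine measure_eq_zero_iff_ae_notMem.2 (hfin.mono fun ω hlt hω => ?_)
    exact (Set.mem_iInter.1 hω (𝕏.τ ω).toNNReal).ne (ENNReal.coe_toNNReal hlt.ne)
  have hlim := tendsto_measure_iInter_atTop (μ := 𝕏.pr x)
    (fun t : ℝ≥0 => (𝕏.measurable_X t measurableSet_range_inl).nullMeasurableSet.congr
      (𝕏.lt_τ_ae_eq_pr x t).symm)
    (fun _ _ hst _ hω => lt_of_le_of_lt (ENNReal.coe_le_coe.2 hst) hω) ⟨0, measure_ne_top _ _⟩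
  rw [hnull] at hlim
  simp only [← survival_pr]
  exact (ENNReal.tendsto_toReal ENNReal.zero_ne_top).comp hlim

lemma doeblin {ν : Measure E} [IsProbabilityMeasure ν] {t₀ : ℝ≥0} {c₁ c₂ : ℝ}
    (hpos : ∀ (t : ℝ≥0) (x : E), 0 < 𝕏.survival (𝕏.pr x) t) (ht₀ : 0 < t₀) (hc₁ : 0 < c₁)
    (hc₂ : 0 < c₂) (hA1 : 𝕏.CondA1 ν t₀ c₁) (hA2 : 𝕏.CondA2 ν c₂) :
    𝕏.toSemigroup.Doeblin ν t₀ c₁ c₂ where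
  survival_pos t x := 𝕏.survival_pr x t ▸ hpos t x
  prob := inferInstance
  t₀_pos := ht₀
  c₁_pos := hc₁
  c₂_pos := hc₂
  minorization x := 𝕏.condLaw_pr x t₀ ▸ hA1 x
  survival_le t x := by simpa only [survival_pr, survival_prInit] using hA2 t x

end Semigroup

section SpectralData

variable {E Ω : Type*} [MeasurableSpace E] [MeasurableSpace Ω] {𝕏 : AbsorbedMarkovProcess E Ω}
  {ν : Measure E} {t₀ : ℝ≥0} {c₁ c₂ : ℝ}

lemma exists_isSpectralData (H : 𝕏.toSemigroup.Doeblin ν t₀ c₁ c₂)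
    (hfin : ∀ x, ∀ᵐ ω ∂(𝕏.pr x), 𝕏.τ ω < ∞) :
    ∃ (α : Measure E) (η : E → ℝ) (lam γ C C' C'' : ℝ),
      𝕏.IsSpectralData α η lam γ C C' C'' := by
  have := H.prob
  let C := 2 * Real.exp (c₁ * c₂)
  have F : 𝕏.toSemigroup.ForgetsInitialLaw C (c₁ * c₂ / t₀) := H.forgetsInitialLaw
  obtain ⟨α, hα⟩ := F.exists_isQuasiStationary H.survival_pos ν
  have := hα.prob
  obtain ⟨lam, hlam, hsurv⟩ :=
    hα.exists_integral_survival_eq_exp fun x => tendsto_survival_zero (hfin x)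
  have htv (μ : Measure E) [IsProbabilityMeasure μ] (t : ℝ≥0) :
      tvDist (toForm (𝕏.toSemigroup.condLaw μ t)) (toForm α) ≤
        ENNReal.ofReal (C * Real.exp (-(c₁ * c₂ / t₀) * t)) := by
    simpa only [hα.condLaw_eq] using F.tvDist_condLaw_le μ α t
  let K := 1 / (c₁ * c₂)
  have D : 𝕏.toSemigroup.ExpDecay K lam := ⟨hlam, fun t x => by
    rw [one_div_mul_eq_div, le_div_iff₀' (mul_pos H.c₁_pos H.c₂_pos), ← hsurv]
    exact H.mul_survival_le_integral hα t x⟩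
  obtain ⟨η, hη, hη0, hη1, happrox⟩ := D.exists_scaledSurvival_limit hsurv
    (fun t => mul_nonneg F.C_pos.le (Real.exp_pos _).le)
    (tendsto_mul_exp_neg_mul_atTop _ F.γ_pos) fun x t => htv (Measure.dirac x) t
  refine ⟨α, η, lam, c₁ * c₂ / t₀, C, K * (K * C), K, ⟨hα.prob, fun t => ?_⟩, hlam,
    fun t => ?_, F.C_pos, F.γ_pos, fun μ hμ t => ?_, hη, hη0, hη1, fun x t => ?_, fun x t => ?_⟩
  · rw [condLaw_prInit, hα.condLaw_eq]
  · rw [survival_prInit, hsurv]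
  · rw [condLaw_prInit]
    exact htv μ t
  · rw [survival_pr, mul_assoc, mul_assoc]
    exact happrox x t
  · rw [survival_pr]
    exact D.survival_le t x

namespace IsSpectralData

variable {α μ : Measure E} {η : E → ℝ} {lam γ C C' C'' : ℝ}

lemma expDecay (h : 𝕏.IsSpectralData α η lam γ C C' C'') : 𝕏.toSemigroup.ExpDecay C'' lam :=
  ⟨h.lam_pos, fun t x => 𝕏.survival_pr x t ▸ h.survival_le x t⟩

lemma rate_add_pos (h : 𝕏.IsSpectralData α η lam γ C C' C'') : 0 < lam + γ :=
  add_pos h.lam_pos h.γ_pos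

lemma abs_scaledSurvival_sub_le (h : 𝕏.IsSpectralData α η lam γ C C' C'') (t : ℝ≥0) (x : E) :
    |𝕏.toSemigroup.scaledSurvival lam t x - η x| ≤ C' * Real.exp (-γ * t) := by
  rw [SubMarkovSemigroup.scaledSurvival, ← survival_pr]
  exact h.η_approx x t

lemma η_pos (h : 𝕏.IsSpectralData α η lam γ C C' C'') (H : 𝕏.toSemigroup.Doeblin ν t₀ c₁ c₂)
    (x : E) : 0 < η x := by
  have := h.quasiStationary.1
  refine H.limit_scaledSurvival_pos (x := x)
    (fun t => (𝕏.survival_prInit α t).symm.trans (h.survival_eq t)) ?_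
  exact tendsto_iff_norm_sub_tendsto_zero.2 (squeeze_zero (fun _ => norm_nonneg _)
    (fun t => h.abs_scaledSurvival_sub_le t x) (tendsto_mul_exp_neg_mul_atTop C' h.γ_pos))

lemma error_const_nonneg (h : 𝕏.IsSpectralData α η lam γ C C' C'') (x : E) :
    0 ≤ C * C'' + C' := by
  have hC' : 0 ≤ C' := by
    simpa using (abs_nonneg _).trans (h.abs_scaledSurvival_sub_le 0 x)
  exact add_nonneg (mul_nonneg h.C_pos.le (h.expDecay.bound_nonneg x)) hC'

lemma abs_op_sub_le (h : 𝕏.IsSpectralData α η lam γ C C' C'') {f : E → ℝ} (hf : IsBddMeas f)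
    (x : E) (t : ℝ≥0) :
    |𝕏.toSemigroup.op t f x - (∫ y, f y ∂α) * η x * Real.exp (-lam * t)| ≤
      (C * C'' + C') * supNorm f * Real.exp (-(lam + γ) * t) := by
  have := h.quasiStationary.1
  have htv := h.tv_le (Measure.dirac x) inferInstance t
  rw [condLaw_prInit] at htv
  refine (h.expDecay.abs_op_sub_le hf (mul_nonneg h.C_pos.le (Real.exp_pos _).le) htv
    (h.abs_scaledSurvival_sub_le t x)).trans_eq ?_
  rw [neg_add, add_mul (-lam), Real.exp_add]
  ring

lemma abs_green_iterate_sub_le (h : 𝕏.IsSpectralData α η lam γ C C' C'') {f : E → ℝ}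
    (hf : IsBddMeas f) (n : ℕ) (x : E) :
    |(𝕏.green^[n] f) x - (∫ y, f y ∂α) * (1 / lam ^ n) * η x| ≤
      (C * C'' + C') * supNorm f / (lam + γ) ^ n := by
  rw [𝕏.green_iterate_eq hf.1, mul_one_div, div_mul_eq_mul_div]
  exact h.expDecay.abs_green_iterate_sub_le hf h.rate_add_pos (h.abs_op_sub_le hf x) n

lemma abs_expGreen_sub_le (h : 𝕏.IsSpectralData α η lam γ C C' C'') {f : E → ℝ}
    (hf : IsBddMeas f) {t : ℝ} (ht : 0 ≤ t) (x : E) :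
    |𝕏.expGreen t f x - (∫ y, f y ∂α) * Real.exp (t / lam) * η x| ≤
      (C * C'' + C') * supNorm f * Real.exp (t / (lam + γ)) := by
  rw [𝕏.expGreen_eq hf.1, mul_right_comm]
  exact h.expDecay.abs_expGreen_sub_le hf h.rate_add_pos (h.abs_op_sub_le hf x) ht

lemma isBddMeas_green_iterate (h : 𝕏.IsSpectralData α η lam γ C C' C'') {f : E → ℝ}
    (hf : IsBddMeas f) (n : ℕ) : IsBddMeas (𝕏.green^[n] f) := by
  rw [𝕏.green_iterate_eq hf.1]
  exact h.expDecay.isBddMeas_green_iterate hf n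

lemma isBddMeas_expGreen (h : 𝕏.IsSpectralData α η lam γ C C' C'') {f : E → ℝ}
    (hf : IsBddMeas f) {t : ℝ} (ht : 0 ≤ t) : IsBddMeas (𝕏.expGreen t f) := by
  rw [𝕏.expGreen_eq hf.1]
  exact h.expDecay.isBddMeas_expGreen hf ht

lemma green_iterate_one_pos (h : 𝕏.IsSpectralData α η lam γ C C' C'')
    (H : 𝕏.toSemigroup.Doeblin ν t₀ c₁ c₂) (n : ℕ) (x : E) : 0 < (𝕏.green^[n] 1) x := by
  rw [𝕏.green_iterate_eq measurable_one]
  exact h.expDecay.green_iterate_pos H.survival_pos .one (fun _ => one_pos) n x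

lemma expGreen_one_pos (h : 𝕏.IsSpectralData α η lam γ C C' C'')
    (H : 𝕏.toSemigroup.Doeblin ν t₀ c₁ c₂) {t : ℝ} (ht : 0 ≤ t) (x : E) :
    0 < 𝕏.expGreen t 1 x := by
  rw [𝕏.expGreen_eq measurable_one]
  exact h.expDecay.expGreen_pos H.survival_pos .one (fun _ => one_pos) ht x

section InitialLaw

variable [IsProbabilityMeasure μ]

lemma abs_greenPow_sub_le (h : 𝕏.IsSpectralData α η lam γ C C' C'') {f : E → ℝ}
    (hf : IsBddMeas f) (n : ℕ) :
    |𝕏.greenPow μ n f - (∫ x, f x ∂α) * (∫ x, η x ∂μ) / lam ^ n| ≤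
      (C * C'' + C') * supNorm f / (lam + γ) ^ n := by
  rw [mul_div_right_comm, div_eq_mul_one_div (∫ x, f x ∂α)]
  exact (h.isBddMeas_green_iterate hf n).abs_integral_sub_mul_integral_le h.η_bddMeas μ
    (h.abs_green_iterate_sub_le hf n)

lemma greenPow_one_pos (h : 𝕏.IsSpectralData α η lam γ C C' C'')
    (H : 𝕏.toSemigroup.Doeblin ν t₀ c₁ c₂) (n : ℕ) : 0 < 𝕏.greenPow μ n 1 :=
  (h.isBddMeas_green_iterate .one n).integral_pos (h.green_iterate_one_pos H n) μ

lemma greenExp_one_pos (h : 𝕏.IsSpectralData α η lam γ C C' C'')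
    (H : 𝕏.toSemigroup.Doeblin ν t₀ c₁ c₂) {t : ℝ} (ht : 0 ≤ t) : 0 < 𝕏.greenExp μ t 1 :=
  (h.isBddMeas_expGreen .one ht).integral_pos (h.expGreen_one_pos H ht) μ

lemma mul_supNorm_le (h : 𝕏.IsSpectralData α η lam γ C C' C'') {f : E → ℝ}
    (hf : ∀ x, |f x| ≤ 1) (x : E) : (C * C'' + C') * supNorm f ≤ C * C'' + C' :=
  mul_le_of_le_one_right (h.error_const_nonneg x) (Real.iSup_le hf zero_le_one)

lemma tvDist_greenPow_le (h : 𝕏.IsSpectralData α η lam γ C C' C'')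
    (H : 𝕏.toSemigroup.Doeblin ν t₀ c₁ c₂) (n : ℕ) :
    tvDist (fun f => 𝕏.greenPow μ n f / 𝕏.greenPow μ n 1) (toForm α) ≤
      ENNReal.ofReal
        (2 * (C * C'' + C') / (∫ x, η x ∂μ) * (lam / (lam + γ)) ^ n) := by
  have := h.quasiStationary.1
  have hη := h.η_bddMeas.integral_pos (h.η_pos H) μ
  have hρ := h.rate_add_pos
  refine (tvDist_integral_div_le (T := fun f => 𝕏.green^[n] f)
    (one_div_pos.2 (pow_pos h.lam_pos n)) h.η_bddMeas hη
    (fun f hf => h.isBddMeas_green_iterate hf n) (h.green_iterate_one_pos H n)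
    (fun f hf hf1 => ?_) (r := (C * C'' + C') / (lam + γ) ^ n) fun f hf hf1 x => ?_).trans_eq
    (congrArg _ ?_)
  · rw [𝕏.green_iterate_eq hf.1, 𝕏.green_iterate_eq measurable_one]
    exact h.expDecay.abs_green_iterate_le_green_iterate .one hf1 n
  · exact (h.abs_green_iterate_sub_le hf n x).trans
      (div_le_div_of_nonneg_right (h.mul_supNorm_le hf1 x) (pow_pos hρ n).le)
  · rw [div_pow]
    field_simp

lemma tvDist_greenExp_le (h : 𝕏.IsSpectralData α η lam γ C C' C'')
    (H : 𝕏.toSemigroup.Doeblin ν t₀ c₁ c₂) {t : ℝ} (ht : 0 ≤ t) :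
    tvDist (fun f => 𝕏.greenExp μ t f / 𝕏.greenExp μ t 1) (toForm α) ≤
      ENNReal.ofReal (2 * (C * C'' + C') / (∫ x, η x ∂μ) *
        Real.exp (-t * (γ / (lam * (lam + γ))))) := by
  have := h.quasiStationary.1
  have hη := h.η_bddMeas.integral_pos (h.η_pos H) μ
  have hrate : -t * (γ / (lam * (lam + γ))) = t / (lam + γ) - t / lam := by
    have := h.lam_pos
    have := h.rate_add_pos
    field_simp
    ring
  refine (tvDist_integral_div_le (T := 𝕏.expGreen t) (Real.exp_pos (t / lam)) h.η_bddMeas hη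
    (fun f hf => h.isBddMeas_expGreen hf ht) (h.expGreen_one_pos H ht) (fun f hf hf1 => ?_)
    (r := (C * C'' + C') * Real.exp (t / (lam + γ))) fun f hf hf1 x => ?_).trans_eq
    (congrArg _ ?_)
  · rw [𝕏.expGreen_eq hf.1, 𝕏.expGreen_eq measurable_one]
    exact h.expDecay.abs_expGreen_le_expGreen .one hf1 ht
  · exact (h.abs_expGreen_sub_le hf ht x).trans
      (mul_le_mul_of_nonneg_right (h.mul_supNorm_le hf1 x) (Real.exp_pos _).le)
  · rw [hrate, Real.exp_sub]
    field_simp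

end InitialLaw

end IsSpectralData

end SpectralData

end AbsorbedMarkovProcess

end

theorem proposition2 {E Ω : Type*} [MeasurableSpace E] [MeasurableSpace Ω]
    (𝕏 : AbsorbedMarkovProcess E Ω)
    (hfin : ∀ x, ∀ᵐ ω ∂(𝕏.pr x), 𝕏.τ ω < ∞)
    (hpos : ∀ (t : ℝ≥0) (x : E), 0 < 𝕏.survival (𝕏.pr x) t)
    (hA : ∃ (ν : Measure E) (t₀ : ℝ≥0) (c₁ c₂ : ℝ), IsProbabilityMeasure ν ∧
      0 < t₀ ∧ 0 < c₁ ∧ 0 < c₂ ∧ 𝕏.CondA1 ν t₀ c₁ ∧ 𝕏.CondA2 ν c₂) :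
    -- the objects and constants of the statement exist
    (∃ (α : Measure E) (η : E → ℝ) (lam γ C C' C'' : ℝ), 𝕏.IsSpectralData α η lam γ C C' C'') ∧
    -- the Green operator is well defined and bounded, and its exponential series converges
    (∃ K : ℝ, ∀ f : E → ℝ, IsBddMeas f →
      (∀ x, IntegrableOn (fun s : ℝ => 𝕏.semigroup s.toNNReal f x) (Set.Ioi 0)) ∧
      IsBddMeas (𝕏.green f) ∧ supNorm (𝕏.green f) ≤ K * supNorm f ∧
      ∀ (t : ℝ) (x : E), Summable (fun n : ℕ => t ^ n / (n.factorial : ℝ) * (𝕏.green^[n] f) x)) ∧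
    -- the estimates, for any choice of these objects and constants
    ∀ (α : Measure E) (η : E → ℝ) (lam γ C C' C'' : ℝ), 𝕏.IsSpectralData α η lam γ C C' C'' →
      (∀ μ : Measure E, IsProbabilityMeasure μ → ∀ f : E → ℝ, IsBddMeas f → ∀ n : ℕ, 1 ≤ n →
        |𝕏.greenPow μ n f - (∫ x, f x ∂α) * (∫ x, η x ∂μ) / lam ^ n| ≤
          (C * C'' + C') * supNorm f / (lam + γ) ^ n) ∧
      ∃ B : ℝ, ∀ μ : Measure E, IsProbabilityMeasure μ →
        0 < ∫ x, η x ∂μ ∧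
        (∀ n : ℕ, 1 ≤ n → 0 < 𝕏.greenPow μ n 1 ∧
          tvDist (fun f => 𝕏.greenPow μ n f / 𝕏.greenPow μ n 1) (toForm α) ≤
            ENNReal.ofReal (B / (∫ x, η x ∂μ) * (lam / (lam + γ)) ^ n)) ∧
        (∀ t : ℝ, 0 ≤ t → 0 < 𝕏.greenExp μ t 1 ∧
          tvDist (fun f => 𝕏.greenExp μ t f / 𝕏.greenExp μ t 1) (toForm α) ≤
            ENNReal.ofReal (B / (∫ x, η x ∂μ) * Real.exp (-t * (γ / (lam * (lam + γ)))))) := by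
  obtain ⟨ν, t₀, c₁, c₂, hν, ht₀, hc₁, hc₂, hA1, hA2⟩ := hA
  have H := AbsorbedMarkovProcess.doeblin hpos ht₀ hc₁ hc₂ hA1 hA2
  obtain ⟨α₀, η₀, lam₀, γ₀, C₀, C₀', K, h₀⟩ := AbsorbedMarkovProcess.exists_isSpectralData H hfin
  refine ⟨⟨α₀, η₀, lam₀, γ₀, C₀, C₀', K, h₀⟩, ⟨K / lam₀, fun f hf => ?_⟩,
    fun α η lam γ C C' C'' h => ⟨fun μ _ f hf n _ => h.abs_greenPow_sub_le hf n,
      2 * (C * C'' + C'), fun μ _ => ⟨h.η_bddMeas.integral_pos (h.η_pos H) μ,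
        fun n _ => ⟨h.greenPow_one_pos H n, h.tvDist_greenPow_le H n⟩,
        fun t ht => ⟨h.greenExp_one_pos H ht, h.tvDist_greenExp_le H ht⟩⟩⟩⟩
  simp only [𝕏.semigroup_eq hf.1, 𝕏.green_eq hf.1, 𝕏.green_iterate_eq hf.1]
  exact ⟨h₀.expDecay.integrableOn_op hf, h₀.expDecay.isBddMeas_green hf,
    h₀.expDecay.supNorm_green_le hf, h₀.expDecay.summable_expGreen hf⟩
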